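/- **Setting.** Let $T\ge 2$ be fixed and let $p=p_n$ satisfy $p_n\to\infty$ and $\log(p_n)/n\to 0$ as $n\to\infty$. For each $n$ let $W=(W_{k,t})_{1\le k\le p,\,0\le t\le T}$ be a random matrix on a probability space $(\Omega,\mathcal F,P)$ with square-integrable entries (its law may depend on $n$), and let $W^{(1)},\dots,W^{(n)}$ be i.i.d. copies of $W$. Put $X=(W_{\{\cdot,0\}},\dots,W_{\{\cdot,T-1\}})$ and $Y=(W_{\{\cdot,1\}},\dots,W_{\{\cdot,T\}})$, both in $\mathbb R^{p\times T}$, and define $X^{(i)},Y^{(i)}$ from $W^{(i)}$ in the same way. For $t\in\{1,\dots,T\}$ let $U_t=\{1,\dots,t\}$, $V_t=\{t+1,\dots,T\}$, and let $\mathcal L_t$ be the set of predictors $$L(X)=b+(AX_{\{\cdot,1\}},\dots,AX_{\{\cdot,t\}},A'X_{\{\cdot,t+1\}},\dots,A'X_{\{\cdot,T\}}),\qquad b\in\mathbb R^{p\times T},\ A,A'\in\mathbb R^{p\times p}.$$ Let $R(L)=p^{-1}E\|Y-L(X)\|_F^2$, let $L_t^\star\in\operatorname{argmin}_{L\in\mathcal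 L_t}R(L)$, and let $A_t^\star$ and $A_t^{\star\prime}$ be its matrices on the periods $U_t$ and $V_t$. (For $t=T$ there is a single matrix, $A^\star_T$.) For a set $S$ of columns let $\Sigma_S=E[(X_{\{\cdot,S\}}-EX_{\{\cdot,S\}})(X_{\{\cdot,S\}}-EX_{\{\cdot,S\}})^{T}]$. Let $\epsilon=Y-L_T^\star(X)$ and let $\sigma=\sigma_n\ge 0$ be the infimum of the $s>0$ such that, almost surely, $E[\epsilon_{k,j}^2\mid X_{\{\cdot,j\}}]\le s^2$ for all $k\in\{1,\dots,p\}$ and $j\in\{1,\dots,T\}$. **Assumptions.** 1. There is a constant $B$ such that, for all $n$ large enough, almost surely $|W_{k,t}|\le B$ for all $k\in\{1,\dots,p\}$ and $t\in\{0,\dots,T\}$. 2. $\liminf_{n\to\infty}\sigma_n>0$. 3. There are constants $s\in\mathbb N$ and $\gamma>0$ such that the following holds for all $n$ large enough, for every $(S,A)=(U_t,A_t^\star)$ with $1\le t\le T$ and every $(S,A)=(V_t,A_t^{\star\prime})$ with $1\le t\le T-1$, and for every $k\in\{1,\dots,p\}$: the set $S_k=\{\ell: A_{k,\ell}\ne 0\}$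 has at most $s$ elements, and $u^{T}\Sigma_S u\ge\gamma\|u\|_2^2$ for all $u\in\mathbb R^p$ with $\sum_{\ell\notin S_k}|u_\ell|\le 3\sum_{\ell\in S_k}|u_\ell|$. 4. There is $t^\star\in\{1,\dots,T-1\}$ such that $\limsup_{n\to\infty}R(L^\star_{t^\star})<\liminf_{n\to\infty}R(L^\star_t)$ for all $t\in\{1,\dots,T\}$ with $t\neq t^\star$. **Estimator.** Let $K\ge 2$ be fixed. For each $n$ divisible by $K$, let $\mathcal F$ be a partition of $\{1,\dots,n\}$ into $K$ folds of size $n/K$. For $I\in\mathcal F$, with $J=\{1,\dots,n\}\setminus I$, and $t\in\{1,\dots,T\}$, let $$(\hat b_{J,t},\hat A_{J,t})\in\operatorname*{argmin}_{b\in\mathbb R^{p\times t},\,A\in\mathbb R^{p\times p}}\ \sum_{i\in J}\|Y^{(i)}_{\{\cdot,U_t\}}-b-AX^{(i)}_{\{\cdot,U_t\}}\|_F^2+2\lambda\sum_{k,\ell}|A_{k,\ell}|,$$ let $(\hat b'_{J,t},\hat A'_{J,t})$ be a minimizer of the same objective with $V_t$ in place of $U_t$ and $b\in\mathbb R^{p\times(T-t)}$,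 and let $$\hat R_t=\frac1K\sum_{I\in\mathcal F}\frac{K}{np}\sum_{i\in I}\Big\{\|Y^{(i)}_{\{\cdot,U_t\}}-\hat b_{J,t}-\hat A_{J,t}X^{(i)}_{\{\cdot,U_t\}}\|_F^2+\|Y^{(i)}_{\{\cdot,V_t\}}-\hat b'_{J,t}-\hat A'_{J,t}X^{(i)}_{\{\cdot,V_t\}}\|_F^2\Big\},\qquad \hat t\in\operatorname*{argmin}_{t=1,\dots,T}\hat R_t .$$ **Conclusion.** There is a constant $C_0>0$, not depending on $n$, such that for every $C\ge C_0$, if $\lambda=C\sqrt{n\sigma_n^2\log(p_n)}$, then for all choices of $K$, of the folds, of the minimizers and of $\hat t$ (a random variable), $$P(\hat t=t^\star)\to 1\qquad\text{as } n\to\infty \text{ along the multiples of } K .$$ -/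

import Mathlib

open MeasureTheory ProbabilityTheory Filter Topology

noncomputable section

namespace RegimeSwitch

/-- One day of observations: a `p × (T+1)` array `w`, `w k t` being the value of variable `k`
at time `t ∈ {0, …, T}`. -/
abbrev Day (p T : ℕ) : Type := Fin p → Fin (T + 1) → ℝ

/-- The covariate matrix `X = (w_0, …, w_{T-1})`; column `j : Fin T` is the column number `j + 1`
of `X`. -/
def covariates {p T : ℕ} (w : Day p T) : Matrix (Fin p) (Fin T) ℝ :=
  Matrix.of fun k j => w k j.castSucc

/-- The output matrix `Y = (w_1, …, w_T)`. -/
def outputs {p T : ℕ} (w : Day p T) : Matrix (Fin p) (Fin T) ℝ :=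
  Matrix.of fun k j => w k j.succ

/-- The columns `U_t = {1, …, t}` (column number `j + 1` is at most `t`). -/
def before (T t : ℕ) : Finset (Fin T) := Finset.univ.filter fun j => (j : ℕ) + 1 ≤ t

/-- The columns `V_t = {t + 1, …, T}`. -/
def after (T t : ℕ) : Finset (Fin T) := Finset.univ.filter fun j => t < (j : ℕ) + 1

/-- Parameters `(b, A, A')` of a linear predictor with two regimes. -/
structure Params (p T : ℕ) where
  b : Matrix (Fin p) (Fin T) ℝ
  A : Matrix (Fin p) (Fin p) ℝ
  A' : Matrix (Fin p) (Fin p) ℝ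

/-- The predictor `b + (A X_1, …, A X_t, A' X_{t+1}, …, A' X_T)` of the class `𝓛_t`.
For `t = T` it is `b + A X`. -/
def predict {p T : ℕ} (t : ℕ) (L : Params p T) (X : Matrix (Fin p) (Fin T) ℝ) :
    Matrix (Fin p) (Fin T) ℝ :=
  Matrix.of fun k j =>
    L.b k j + if (j : ℕ) + 1 ≤ t then (L.A * X) k j else (L.A' * X) k j

/-- The residual matrix `Y - L(X)` of a predictor of `𝓛_t` on one day. -/
def residual {p T : ℕ} (t : ℕ) (L : Params p T) (w : Day p T) : Matrix (Fin p) (Fin T) ℝ :=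
  outputs w - predict t L (covariates w)

/-- The normalized risk `R(L) = p⁻¹ E ‖Y - L(X)‖_F²` of a predictor of `𝓛_t`. -/
def risk {Ω : Type*} [MeasurableSpace Ω] (P : Measure Ω) {p T : ℕ} (W : Ω → Day p T)
    (t : ℕ) (L : Params p T) : ℝ :=
  (p : ℝ)⁻¹ * ∫ ω, ∑ k, ∑ j, residual t L (W ω) k j ^ 2 ∂P

/-- `L ∈ argmin_{𝓛_t} R`. -/
def IsOptimal {Ω : Type*} [MeasurableSpace Ω] (P : Measure Ω) {p T : ℕ} (W : Ω → Day p T)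
    (t : ℕ) (L : Params p T) : Prop :=
  ∀ L' : Params p T, risk P W t L ≤ risk P W t L'

/-- The noise level `σ` of a predictor of `𝓛_t` with residual `ε = Y - L(X)`: the smallest
`σ > 0` (infimum) with `max_{k,j} E[ε_{k,j}² | X_{·,j}] ≤ σ²` almost surely. -/
def noiseLevel {Ω : Type*} [MeasurableSpace Ω] (P : Measure Ω) {p T : ℕ} (W : Ω → Day p T)
    (t : ℕ) (L : Params p T) : ℝ :=
  sInf {s : ℝ | 0 < s ∧ ∀ᵐ ω ∂P, ∀ (k : Fin p) (j : Fin T),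
    (P[fun ω' => residual t L (W ω') k j ^ 2 |
      MeasurableSpace.comap (fun ω' (l : Fin p) => covariates (W ω') l j) inferInstance]) ω
      ≤ s ^ 2}

/-- The matrix `Σ_S = E[(X_S - E X_S)(X_S - E X_S)ᵀ]`, where `X_S` is the submatrix of `X`
made of the columns in `S`. -/
def blockCov {Ω : Type*} [MeasurableSpace Ω] (P : Measure Ω) {p T : ℕ} (W : Ω → Day p T)
    (S : Finset (Fin T)) : Matrix (Fin p) (Fin p) ℝ :=
  Matrix.of fun k l => ∑ j ∈ S,
    ∫ ω, (covariates (W ω) k j - ∫ ω', covariates (W ω') k j ∂P) *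
      (covariates (W ω) l j - ∫ ω', covariates (W ω') l j ∂P) ∂P

/-- The active set of row `k` of `A`. -/
def activeSet {p : ℕ} (A : Matrix (Fin p) (Fin p) ℝ) (k : Fin p) : Finset (Fin p) :=
  Finset.univ.filter fun l => A k l ≠ 0

/-- The cone `𝓒(S, α) = {u : ‖u_{Sᶜ}‖₁ ≤ α ‖u_S‖₁}`. -/
def cone {p : ℕ} (S : Finset (Fin p)) (α : ℝ) : Set (Fin p → ℝ) :=
  {u | ∑ l ∈ Sᶜ, |u l| ≤ α * ∑ l ∈ S, |u l|}

/-- `‖M^{1/2} u‖₂² = uᵀ M u ≥ γ ‖u‖₂²` for every `u` in one of the cones `𝓒(S_k, 3)`,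
`S_k` being the active set of row `k` of `A`. -/
def RestrictedEigenvalue {p : ℕ} (M A : Matrix (Fin p) (Fin p) ℝ) (γ : ℝ) : Prop :=
  ∀ k : Fin p, ∀ u ∈ cone (activeSet A k) 3, γ * ∑ l, u l ^ 2 ≤ u ⬝ᵥ M.mulVec u

/-- `‖Y_S - b - A X_S‖_F²`, the squared error over the columns in `S`; only the columns of `b`
in `S` play a role. -/
def blockLoss {p T : ℕ} (S : Finset (Fin T)) (b : Matrix (Fin p) (Fin T) ℝ)
    (A : Matrix (Fin p) (Fin p) ℝ) (w : Day p T) : ℝ :=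
  ∑ k, ∑ j ∈ S, (outputs w k j - b k j - (A * covariates w) k j) ^ 2

/-- The Lasso objective `∑_{i ∈ J} ‖Y_S⁽ⁱ⁾ - b - A X_S⁽ⁱ⁾‖_F² + 2 lam ‖A‖₁`. -/
def lassoObjective {p T n : ℕ} (data : Fin n → Day p T) (J : Finset (Fin n))
    (S : Finset (Fin T)) (lam : ℝ) (b : Matrix (Fin p) (Fin T) ℝ)
    (A : Matrix (Fin p) (Fin p) ℝ) : ℝ :=
  ∑ i ∈ J, blockLoss S b A (data i) + 2 * lam * ∑ k, ∑ l, |A k l|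

/-- `L = (b, A, A')` is a Lasso fit with change point `t` on the sample `J`: the columns `U_t` of
`b` and `A` minimize the Lasso objective over the period `U_t`, the columns `V_t` of `b` and `A'`
minimize it over the period `V_t`. -/
def IsLassoFit {p T n : ℕ} (data : Fin n → Day p T) (J : Finset (Fin n)) (lam : ℝ) (t : ℕ)
    (L : Params p T) : Prop :=
  (∀ b A, lassoObjective data J (before T t) lam L.b L.A ≤
    lassoObjective data J (before T t) lam b A) ∧
  (∀ b A, lassoObjective data J (after T t) lam L.b L.A' ≤
    lassoObjective data J (after T t) lam b A)

/-- The fold `I_κ` of the partition of `{1, …, n}` encoded by the labelling `fold`. -/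
def foldSet {n K : ℕ} (fold : Fin n → Fin K) (κ : Fin K) : Finset (Fin n) :=
  Finset.univ.filter fun i => fold i = κ

/-- The cross-validated risk `R̂_t = K⁻¹ ∑_I R̂_{I,t}`, where
`R̂_{I,t} = K / (n p) ∑_{i ∈ I} (‖Y_{U_t}⁽ⁱ⁾ - b̂ - Â X_{U_t}⁽ⁱ⁾‖_F² + ‖Y_{V_t}⁽ⁱ⁾ - b̂' - Â' X_{V_t}⁽ⁱ⁾‖_F²)`
and `est κ` are the parameters fitted without the fold `κ`. -/
def cvRisk {p T n K : ℕ} (data : Fin n → Day p T) (fold : Fin n → Fin K)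
    (est : Fin K → Params p T) (t : ℕ) : ℝ :=
  (K : ℝ)⁻¹ * ∑ κ, (K : ℝ) / ((n : ℝ) * (p : ℝ)) * ∑ i ∈ foldSet fold κ,
    (blockLoss (before T t) (est κ).b (est κ).A (data i) +
      blockLoss (after T t) (est κ).b (est κ).A' (data i))

end RegimeSwitch

end

/-! The squared error splits over output rows `k` and over the two periods. On each piece,
minimizing out the intercepts leaves a quadratic function of the slope whose coefficients are
variances and covariances (`rowLoss_eq`). This holds under every law with second moments, in
particular under the uniform law on a finite sample. Training loss, test loss and population risk
are thus one functional evaluated at three laws, and only moments need comparing.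

Hoeffding's inequality and a union bound make all first and second moments, on every fold and its
complement, accurate to order `√(log p / n)` outside an event of probability `O(1/p)`
(`measure_not_forall_momentsClose_le`). The rest is deterministic. `lasso_l1_error` bounds the error
of each Lasso row in `ℓ¹` by a multiple of `lam / |J|`; `abs_rowLoss_lasso_sub_le` turns this into
closeness of the test loss to the optimal risk. The sparse optimal rows have bounded `ℓ¹` norm
(`sum_abs_slope_le`), which keeps all constants independent of `n`. Bounded data also bound the
noise level (`noiseLevel_le`), so `lam / n` tends to zero, while its lower bound lets a fixed `C`
make the penalty dominate the moment errors.

Hence the cross-validated risks of all `t` approach the optimal risks at once, and the asymptotic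
gap at `tstar` forces the selection. -/

namespace RegimeSwitch

/-! ### Quadratic risks and the deterministic Lasso bound. -/

section Quadratic

variable {ι : Type*} [Fintype ι]

lemma abs_dotProduct_le {u v : ι → ℝ} {τ : ℝ} (h : ∀ i, |v i| ≤ τ) :
    |u ⬝ᵥ v| ≤ (∑ i, |u i|) * τ := by
  rw [dotProduct, Finset.sum_mul]
  refine (Finset.abs_sum_le_sum_abs _ _).trans (Finset.sum_le_sum fun i _ => ?_)
  rw [abs_mul]
  exact mul_le_mul_of_nonneg_left (h i) (abs_nonneg _)

lemma abs_mulVec_le {M : Matrix ι ι ℝ} {u : ι → ℝ} {τ : ℝ} (h : ∀ i j, |M i j| ≤ τ) (i : ι) :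
    |M.mulVec u i| ≤ (∑ j, |u j|) * τ := by
  rw [Matrix.mulVec, dotProduct_comm]
  exact abs_dotProduct_le (h i)

lemma abs_quadratic_le {M : Matrix ι ι ℝ} {u : ι → ℝ} {τ : ℝ} (h : ∀ i j, |M i j| ≤ τ) :
    |u ⬝ᵥ M.mulVec u| ≤ (∑ j, |u j|) ^ 2 * τ := by
  have := abs_dotProduct_le (u := u) (abs_mulVec_le (u := u) h)
  linarith

/-- The quadratic function `a ↦ v - 2 aᵀ c + aᵀ C a`. -/
def quadRisk (v : ℝ) (c : ι → ℝ) (C : Matrix ι ι ℝ) (a : ι → ℝ) : ℝ :=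
  v - 2 * (a ⬝ᵥ c) + a ⬝ᵥ C.mulVec a

lemma quadRisk_add_sub {v : ℝ} {c : ι → ℝ} {C : Matrix ι ι ℝ} (hC : C.IsSymm) (a u : ι → ℝ) :
    quadRisk v c C (a + u) - quadRisk v c C a =
      2 * (u ⬝ᵥ (C.mulVec a - c)) + u ⬝ᵥ C.mulVec u := by
  have h : a ⬝ᵥ C.mulVec u = u ⬝ᵥ C.mulVec a := by
    rw [Matrix.dotProduct_mulVec, ← Matrix.mulVec_transpose, hC.eq, dotProduct_comm]
  simp only [quadRisk, Matrix.mulVec_add, add_dotProduct, dotProduct_add, dotProduct_sub, h]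
  ring

lemma eq_zero_of_forall_quadratic_nonneg {x y : ℝ} (h : ∀ t : ℝ, 0 ≤ t * x + t ^ 2 * y) :
    x = 0 := by
  by_contra hx
  have hd : 0 < |y| + 1 := by positivity
  -- A step against the sign of `x`, short enough that the linear term beats the quadratic one.
  have h1 := h (-x / (|y| + 1))
  have h2 : -x / (|y| + 1) * x + (-x / (|y| + 1)) ^ 2 * y =
      x ^ 2 / (|y| + 1) ^ 2 * (y - (|y| + 1)) := by
    field_simp
    ring
  rw [h2] at h1
  have h3 : 0 < x ^ 2 / (|y| + 1) ^ 2 := by positivity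
  have h4 := le_abs_self y
  nlinarith

lemma mulVec_eq_of_quadRisk_le {v : ℝ} {c : ι → ℝ} {C : Matrix ι ι ℝ} (hC : C.IsSymm) {a : ι → ℝ}
    (ha : ∀ a', quadRisk v c C a ≤ quadRisk v c C a') : C.mulVec a = c := by
  set g := C.mulVec a - c with hg
  have h0 : 2 * (g ⬝ᵥ g) = 0 := by
    refine eq_zero_of_forall_quadratic_nonneg (y := g ⬝ᵥ C.mulVec g) fun t => ?_
    have h1 := quadRisk_add_sub (v := v) (c := c) hC a (t • g)
    rw [← hg] at h1
    simp only [Matrix.mulVec_smul, smul_dotProduct, dotProduct_smul, smul_eq_mul] at h1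
    have h2 := ha (a + t • g)
    linarith
  have h1 : g = 0 := dotProduct_self_eq_zero.1 (by linarith)
  exact sub_eq_zero.1 h1

/-- At a critical point the linear term of the expansion vanishes, so an `ℓ¹` error `r` in the slope
costs only order `r ^ 2`. -/
lemma quadRisk_sub_eq {v : ℝ} {c : ι → ℝ} {C : Matrix ι ι ℝ} (hC : C.IsSymm) {a : ι → ℝ}
    (ha : C.mulVec a = c) (a' : ι → ℝ) :
    quadRisk v c C a' - quadRisk v c C a = (a' - a) ⬝ᵥ C.mulVec (a' - a) := by
  have h := quadRisk_add_sub (v := v) (c := c) hC a (a' - a)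
  rw [add_sub_cancel, ha, sub_self, dotProduct_zero] at h
  linarith

/-- The risk is the quadratic form of the joint second-moment matrix at the vector `(1, -a)`, whose
`ℓ¹` norm is `1 + ∑ i, |a i|`. -/
lemma abs_quadRisk_sub_le {v v' τ : ℝ} {c c' : ι → ℝ} {C C' : Matrix ι ι ℝ} (hv : |v' - v| ≤ τ)
    (hc : ∀ i, |c' i - c i| ≤ τ) (hC : ∀ i j, |C' i j - C i j| ≤ τ) (a : ι → ℝ) :
    |quadRisk v' c' C' a - quadRisk v c C a| ≤ (1 + ∑ i, |a i|) ^ 2 * τ := by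
  have h1 := abs_dotProduct_le (u := a) (v := c' - c) hc
  have h2 := abs_quadratic_le (u := a) (M := C' - C) hC
  have h3 : quadRisk v' c' C' a - quadRisk v c C a =
      (v' - v) - 2 * (a ⬝ᵥ (c' - c)) + a ⬝ᵥ (C' - C).mulVec a := by
    simp only [quadRisk, dotProduct_sub, Matrix.sub_mulVec]
    ring
  rw [h3]
  rw [abs_le] at *
  constructor <;> nlinarith

lemma sq_sum_abs_le {S : Finset ι} {s : ℕ} (hS : S.card ≤ s) (u : ι → ℝ) :
    (∑ i ∈ S, |u i|) ^ 2 ≤ s * ∑ i, u i ^ 2 := by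
  have h1 := sq_sum_le_card_mul_sum_sq (s := S) (f := fun i => |u i|)
  simp only [sq_abs] at h1
  have h2 : ∑ i ∈ S, u i ^ 2 ≤ ∑ i, u i ^ 2 :=
    Finset.sum_le_sum_of_subset_of_nonneg (Finset.subset_univ _) fun _ _ _ => sq_nonneg _
  have h3 : (0 : ℝ) ≤ ∑ i, u i ^ 2 := Finset.sum_nonneg fun _ _ => sq_nonneg _
  have h4 : (S.card : ℝ) ≤ s := by exact_mod_cast hS
  have h5 : (0 : ℝ) ≤ S.card := by positivity
  nlinarith

/-- The `ℓ¹` error of the Lasso under a compatibility condition on the population quadratic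
form. -/
lemma lasso_l1_error [DecidableEq ι] {v' : ℝ} {c c' : ι → ℝ} {C C' : Matrix ι ι ℝ}
    {a a' : ι → ℝ} {S : Finset ι} {s : ℕ} {M γ τ lam : ℝ}
    (hC' : C'.IsSymm) (hpsd : ∀ u, 0 ≤ u ⬝ᵥ C'.mulVec u) (hnormal : C.mulVec a = c)
    (hcdev : ∀ i, |c' i - c i| ≤ τ) (hCdev : ∀ i j, |C' i j - C i j| ≤ τ)
    (hS : S.card ≤ s) (haS : ∀ i ∉ S, a i = 0) (haM : ∑ i, |a i| ≤ M) (hγ : 0 < γ)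
    (hRE : ∀ u : ι → ℝ, ∑ i ∈ Sᶜ, |u i| ≤ 3 * ∑ i ∈ S, |u i| →
      γ * ∑ i, u i ^ 2 ≤ u ⬝ᵥ C.mulVec u)
    (hlam : 0 < lam) (hτlam : τ * (1 + M) ≤ lam / 2) (hτ : 32 * s * τ ≤ γ) (hτ0 : 0 ≤ τ)
    (hmin : quadRisk v' c' C' a' + 2 * lam * ∑ i, |a' i| ≤
      quadRisk v' c' C' a + 2 * lam * ∑ i, |a i|) :
    ∑ i, |a' i - a i| ≤ 24 * s * lam / γ := by
  set u : ι → ℝ := a' - a with hu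
  have ha' : a' = a + u := by simp [hu]
  -- The population gradient vanishes at `a`, so the empirical one consists of moment deviations
  -- only; `hτlam` puts it below half the penalty level.
  have hgrad : ∀ i, |(C'.mulVec a - c') i| ≤ lam / 2 := fun i => by
    have h1 : (C'.mulVec a - c') i = ((C' - C).mulVec a) i - (c' i - c i) := by
      rw [← hnormal, Matrix.sub_mulVec]
      simp
    have h2 := abs_mulVec_le (u := a) (M := C' - C) hCdev i
    have h3 := hcdev i
    rw [h1]
    refine (abs_sub _ _).trans ?_
    have h4 := mul_le_mul_of_nonneg_right haM hτ0
    linarith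
  have hlin := abs_dotProduct_le (u := u) hgrad
  have hexp := quadRisk_add_sub (v := v') (c := c') hC' a u
  rw [← ha'] at hexp
  have hsplit : ∀ f : ι → ℝ, ∑ i, f i = ∑ i ∈ S, f i + ∑ i ∈ Sᶜ, f i := fun f =>
    (Finset.sum_add_sum_compl S f).symm
  have hcompl : ∑ i ∈ Sᶜ, |a' i| = ∑ i ∈ Sᶜ, |u i| :=
    Finset.sum_congr rfl fun i hi => by
      simp [hu, haS i (Finset.mem_compl.1 hi)]
  have hcompl0 : ∑ i ∈ Sᶜ, |a i| = 0 :=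
    Finset.sum_eq_zero fun i hi => by simp [haS i (Finset.mem_compl.1 hi)]
  have htri : ∑ i ∈ S, |a i| ≤ ∑ i ∈ S, |a' i| + ∑ i ∈ S, |u i| := by
    rw [← Finset.sum_add_distrib]
    refine Finset.sum_le_sum fun i _ => ?_
    have := abs_sub_abs_le_abs_sub (a i) (a' i)
    rw [abs_sub_comm] at this
    simp only [hu, Pi.sub_apply]
    linarith
  rw [hsplit (fun i => |a' i|), hsplit (fun i => |a i|), hcompl, hcompl0] at hmin
  rw [hsplit (fun i => |u i|)] at hlin
  set x := ∑ i ∈ S, |u i| with hx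
  set y := ∑ i ∈ Sᶜ, |u i| with hy
  have hx0 : 0 ≤ x := Finset.sum_nonneg fun _ _ => abs_nonneg _
  have hy0 : 0 ≤ y := Finset.sum_nonneg fun _ _ => abs_nonneg _
  have hq := hpsd u
  -- Optimality gives at most `2 * lam * (x - y)` for the loss increment, and the gradient term is
  -- at most `lam * (x + y)` in absolute value; the sum is the source of the cone constant 3.
  have hkey : u ⬝ᵥ C'.mulVec u ≤ lam * (3 * x - y) := by
    rw [abs_le] at hlin
    nlinarith
  have hcone : y ≤ 3 * x := by
    by_contra hlt
    push Not at hlt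
    nlinarith
  have hre := hRE u hcone
  have hdev := abs_quadratic_le (u := u) (M := C' - C) hCdev
  rw [Matrix.sub_mulVec, dotProduct_sub, hsplit (fun i => |u i|), ← hx, ← hy] at hdev
  have hxs := sq_sum_abs_le hS u
  rw [← hx] at hxs
  set N := ∑ i, u i ^ 2 with hN
  have hN0 : 0 ≤ N := Finset.sum_nonneg fun _ _ => sq_nonneg _
  have hxy : (x + y) ^ 2 ≤ 16 * x ^ 2 := by nlinarith
  -- Restricted eigenvalues pass from `C` to `C'`: on the cone the squared `ℓ¹` norm is at most `16
  -- * s * N`, so `hτ` makes the loss at most half of `γ * N`.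
  have hdev' : u ⬝ᵥ C.mulVec u - u ⬝ᵥ C'.mulVec u ≤ γ / 2 * N := by
    have h1 : (x + y) ^ 2 * τ ≤ 16 * (s * N) * τ :=
      mul_le_mul_of_nonneg_right (by linarith) hτ0
    have h2 := mul_le_mul_of_nonneg_right hτ hN0
    rw [abs_le] at hdev
    nlinarith
  have hmain : γ / 2 * N ≤ 3 * lam * x := by nlinarith
  have hs0 : (0 : ℝ) ≤ s := by positivity
  have hfin : x ≤ 6 * s * lam / γ := by
    rcases hx0.eq_or_lt with h0 | h0
    · rw [← h0]; positivity
    · rw [le_div_iff₀ hγ]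
      -- Combines `x ^ 2 ≤ s * N` with `hmain`; then `x + y ≤ 4 * x` turns 6 into 24.
      have h1 : x * (x * γ) ≤ x * (6 * s * lam) := by nlinarith
      exact le_of_mul_le_mul_left h1 h0
  have hgoal : ∑ i, |a' i - a i| = x + y := by
    rw [hx, hy, ← hsplit (fun i => |u i|)]
    rfl
  rw [hgoal]
  have : 24 * s * lam / γ = 4 * (6 * s * lam / γ) := by ring
  linarith

end Quadratic

/-! ### The loss of one row as a function of moments. -/

section RowLoss

variable {Ω : Type*} [MeasurableSpace Ω]

/-- The expected squared error over the columns in `S` for the output variable `k`. -/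
noncomputable def rowLoss (μ : Measure Ω) {p T : ℕ} (Z : Ω → Day p T) (S : Finset (Fin T))
    (k : Fin p) (b : Fin T → ℝ) (a : Fin p → ℝ) : ℝ :=
  ∑ j ∈ S, ∫ ω, (Z ω k j.succ - b j - ∑ l, a l * Z ω l j.castSucc) ^ 2 ∂μ

/-- The variance of the output variable `k`, summed over the columns in `S`. -/
noncomputable def outputVar (μ : Measure Ω) {p T : ℕ} (Z : Ω → Day p T) (S : Finset (Fin T))
    (k : Fin p) : ℝ :=
  ∑ j ∈ S, Var[fun ω => Z ω k j.succ; μ]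

/-- The covariances of the covariates with the output variable `k`, summed over the columns in
`S`. -/
noncomputable def crossCov (μ : Measure Ω) {p T : ℕ} (Z : Ω → Day p T) (S : Finset (Fin T))
    (k : Fin p) : Fin p → ℝ :=
  fun l => ∑ j ∈ S, cov[fun ω => Z ω l j.castSucc, fun ω => Z ω k j.succ; μ]

/-- The best intercept for the slope `a`. -/
noncomputable def bestIntercept (μ : Measure Ω) {p T : ℕ} (Z : Ω → Day p T) (k : Fin p)
    (a : Fin p → ℝ) (j : Fin T) : ℝ :=
  ∫ ω, Z ω k j.succ ∂μ - ∑ l, a l * ∫ ω, Z ω l j.castSucc ∂μ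

/-- The expected squared error for the output variable `k` with the best intercept. -/
noncomputable def profileRisk (μ : Measure Ω) {p T : ℕ} (Z : Ω → Day p T) (S : Finset (Fin T))
    (k : Fin p) (a : Fin p → ℝ) : ℝ :=
  quadRisk (outputVar μ Z S k) (crossCov μ Z S k) (blockCov μ Z S) a

variable {μ : Measure Ω} {p T : ℕ} {Z : Ω → Day p T}

lemma blockCov_apply (S : Finset (Fin T)) (k l : Fin p) :
    blockCov μ Z S k l =
      ∑ j ∈ S, cov[fun ω => Z ω k j.castSucc, fun ω => Z ω l j.castSucc; μ] := rfl

lemma blockCov_isSymm (S : Finset (Fin T)) : (blockCov μ Z S).IsSymm := by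
  ext k l
  rw [Matrix.transpose_apply, blockCov_apply, blockCov_apply]
  exact Finset.sum_congr rfl fun j _ => covariance_comm _ _

lemma dotProduct_blockCov_mulVec (S : Finset (Fin T)) (u : Fin p → ℝ) :
    u ⬝ᵥ (blockCov μ Z S).mulVec u = ∑ j ∈ S, ∑ l, ∑ l', u l * (u l' *
      cov[fun ω => Z ω l j.castSucc, fun ω => Z ω l' j.castSucc; μ]) := by
  simp only [dotProduct, Matrix.mulVec, blockCov_apply, Finset.mul_sum, Finset.sum_mul]
  conv_rhs => rw [Finset.sum_comm]
  refine Finset.sum_congr rfl fun l _ => ?_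
  conv_rhs => rw [Finset.sum_comm]
  exact Finset.sum_congr rfl fun l' _ => Finset.sum_congr rfl fun j _ => by ring

variable [IsProbabilityMeasure μ]

lemma covariance_linear_self (hZ : ∀ k t, MemLp (fun ω => Z ω k t) 2 μ) (t : Fin (T + 1))
    (u : Fin p → ℝ) :
    cov[fun ω => ∑ l, u l * Z ω l t, fun ω => ∑ l, u l * Z ω l t; μ] =
      ∑ l, ∑ l', u l * (u l' * cov[fun ω => Z ω l t, fun ω => Z ω l' t; μ]) := by
  rw [covariance_fun_sum_fun_sum (fun l => (hZ l t).const_mul (u l))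
    (fun l => (hZ l t).const_mul (u l))]
  refine Finset.sum_congr rfl fun l _ => Finset.sum_congr rfl fun l' _ => ?_
  rw [covariance_const_mul_left, covariance_const_mul_right]

omit [IsProbabilityMeasure μ] in
lemma memLp_linear (hZ : ∀ k t, MemLp (fun ω => Z ω k t) 2 μ) (t : Fin (T + 1))
    (u : Fin p → ℝ) : MemLp (fun ω => ∑ l, u l * Z ω l t) 2 μ :=
  memLp_finsetSum _ fun l _ => (hZ l t).const_mul (u l)

lemma blockCov_nonneg (hZ : ∀ k t, MemLp (fun ω => Z ω k t) 2 μ) (S : Finset (Fin T))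
    (u : Fin p → ℝ) : 0 ≤ u ⬝ᵥ (blockCov μ Z S).mulVec u := by
  rw [dotProduct_blockCov_mulVec]
  refine Finset.sum_nonneg fun j _ => ?_
  rw [← covariance_linear_self hZ,
    covariance_self (memLp_linear hZ j.castSucc u).aestronglyMeasurable.aemeasurable]
  exact variance_nonneg _ _

lemma integral_sq_sub_const {R : Ω → ℝ} (hR : MemLp R 2 μ) (b : ℝ) :
    ∫ ω, (R ω - b) ^ 2 ∂μ = cov[R, R; μ] + (∫ ω, R ω ∂μ - b) ^ 2 := by
  have hR1 : Integrable R μ := hR.integrable one_le_two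
  have hR2 : Integrable (fun ω => R ω ^ 2) μ := hR.integrable_sq
  rw [covariance_eq_sub hR hR]
  have h1 : ∫ ω, (R ω - b) ^ 2 ∂μ = ∫ ω, (R ω ^ 2 - 2 * b * R ω + b ^ 2) ∂μ := by
    congr 1; ext ω; ring
  have h2 : ∫ ω, (R * R) ω ∂μ = ∫ ω, R ω ^ 2 ∂μ := by
    congr 1; ext ω; simp [sq]
  have h3 : Integrable (fun ω => R ω ^ 2 - 2 * b * R ω) μ := hR2.sub (hR1.const_mul _)
  rw [h1, h2, integral_add h3 (integrable_const _),
    integral_sub hR2 (hR1.const_mul _), integral_const_mul]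
  simp
  ring

/-- Bias-variance decomposition of `Y - aᵀX` about the intercept, column by column. -/
lemma rowLoss_eq (hZ : ∀ k t, MemLp (fun ω => Z ω k t) 2 μ) (S : Finset (Fin T)) (k : Fin p)
    (b : Fin T → ℝ) (a : Fin p → ℝ) :
    rowLoss μ Z S k b a =
      profileRisk μ Z S k a + ∑ j ∈ S, (bestIntercept μ Z k a j - b j) ^ 2 := by
  have hterm : ∀ j : Fin T,
      ∫ ω, (Z ω k j.succ - b j - ∑ l, a l * Z ω l j.castSucc) ^ 2 ∂μ =
        Var[fun ω => Z ω k j.succ; μ]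
        - 2 * ∑ l, a l * cov[fun ω => Z ω l j.castSucc, fun ω => Z ω k j.succ; μ]
        + ∑ l, ∑ l', a l * (a l' *
          cov[fun ω => Z ω l j.castSucc, fun ω => Z ω l' j.castSucc; μ])
        + (bestIntercept μ Z k a j - b j) ^ 2 := fun j => by
    have hY := hZ k j.succ
    have hX := memLp_linear hZ j.castSucc a
    have h1 : ∀ ω, (Z ω k j.succ - b j - ∑ l, a l * Z ω l j.castSucc) =
        (Z ω k j.succ - ∑ l, a l * Z ω l j.castSucc) - b j := fun ω => by ring
    simp only [h1]
    have hYX : MemLp (fun ω => Z ω k j.succ - ∑ l, a l * Z ω l j.castSucc) 2 μ := hY.sub hX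
    rw [integral_sq_sub_const hYX, covariance_fun_sub_fun_sub hY hX hY hX,
      integral_sub (hY.integrable one_le_two) (hX.integrable one_le_two),
      integral_finsetSum _ fun l _ => ((hZ l j.castSucc).integrable one_le_two).const_mul _,
      covariance_linear_self hZ, covariance_comm (fun ω => Z ω k j.succ)
        (fun ω => ∑ l, a l * Z ω l j.castSucc),
      covariance_self hY.aestronglyMeasurable.aemeasurable,
      covariance_fun_sum_left (fun l => (hZ l j.castSucc).const_mul (a l)) hY]
    simp only [covariance_const_mul_left, integral_const_mul, bestIntercept]
    ring
  have hc : a ⬝ᵥ crossCov μ Z S k = ∑ j ∈ S, ∑ l, a l *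
      cov[fun ω => Z ω l j.castSucc, fun ω => Z ω k j.succ; μ] := by
    simp only [dotProduct, crossCov, Finset.mul_sum]
    exact Finset.sum_comm
  rw [rowLoss, profileRisk, quadRisk, dotProduct_blockCov_mulVec, hc, outputVar, Finset.mul_sum]
  simp only [hterm, Finset.sum_add_distrib, Finset.sum_sub_distrib]

lemma profileRisk_nonneg (hZ : ∀ k t, MemLp (fun ω => Z ω k t) 2 μ) (S : Finset (Fin T))
    (k : Fin p) (a : Fin p → ℝ) : 0 ≤ profileRisk μ Z S k a := by
  have h := rowLoss_eq hZ S k (bestIntercept μ Z k a) a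
  simp only [sub_self, ne_eq, OfNat.ofNat_ne_zero, not_false_eq_true, zero_pow,
    Finset.sum_const_zero, add_zero] at h
  rw [← h]
  exact Finset.sum_nonneg fun j _ => integral_nonneg fun ω => sq_nonneg _

/-- The term `g` does not see the intercept, so it can be profiled out. Taking `g = 0` covers the
population problem, and an `ℓ¹` penalty covers the Lasso. -/
lemma rowLoss_argmin (hZ : ∀ k t, MemLp (fun ω => Z ω k t) 2 μ) {S : Finset (Fin T)} {k : Fin p}
    {b : Fin T → ℝ} {a : Fin p → ℝ} {g : (Fin p → ℝ) → ℝ}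
    (h : ∀ b' a', rowLoss μ Z S k b a + g a ≤ rowLoss μ Z S k b' a' + g a') :
    (∀ j ∈ S, b j = bestIntercept μ Z k a j) ∧
      ∀ a', profileRisk μ Z S k a + g a ≤ profileRisk μ Z S k a' + g a' := by
  have h' : ∀ a', profileRisk μ Z S k a + ∑ j ∈ S, (bestIntercept μ Z k a j - b j) ^ 2 + g a ≤
      profileRisk μ Z S k a' + g a' := fun a' => by
    have h1 := h (bestIntercept μ Z k a') a'
    rw [rowLoss_eq hZ, rowLoss_eq hZ] at h1
    simpa using h1
  have hnn : ∀ j ∈ S, 0 ≤ (bestIntercept μ Z k a j - b j) ^ 2 := fun _ _ => sq_nonneg _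
  refine ⟨fun j hj => ?_, fun a' => ?_⟩
  · have h0 : ∑ j ∈ S, (bestIntercept μ Z k a j - b j) ^ 2 = 0 :=
      le_antisymm (by linarith [h' a]) (Finset.sum_nonneg hnn)
    have h1 := (Finset.sum_eq_zero_iff_of_nonneg hnn).1 h0 j hj
    have h2 := pow_eq_zero_iff two_ne_zero |>.1 h1
    linarith
  · have := Finset.sum_nonneg hnn
    linarith [h' a']

end RowLoss

/-! ### Separation of the population risk into rows and periods. -/

section Population

variable {Ω : Type*} [MeasurableSpace Ω] {P : Measure Ω} {p T : ℕ} {W : Ω → Day p T}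

lemma sum_residual_sq (t : ℕ) (L : Params p T) (w : Day p T) :
    ∑ k, ∑ j, residual t L w k j ^ 2 =
      ∑ k, (∑ j ∈ before T t, (w k j.succ - L.b k j - ∑ l, L.A k l * w l j.castSucc) ^ 2 +
        ∑ j ∈ after T t, (w k j.succ - L.b k j - ∑ l, L.A' k l * w l j.castSucc) ^ 2) := by
  refine Finset.sum_congr rfl fun k _ => ?_
  simp only [before, after, Finset.sum_filter, ← Finset.sum_add_distrib]
  refine Finset.sum_congr rfl fun j _ => ?_
  simp only [residual, outputs, predict, covariates, Matrix.sub_apply, Matrix.of_apply,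
    Matrix.mul_apply]
  by_cases h : (j : ℕ) + 1 ≤ t
  · rw [if_pos h, if_pos h, if_neg (not_lt.2 h)]; ring
  · rw [if_neg h, if_neg h, if_pos (not_le.1 h)]; ring

lemma blockLoss_eq (S : Finset (Fin T)) (b : Matrix (Fin p) (Fin T) ℝ)
    (A : Matrix (Fin p) (Fin p) ℝ) (w : Day p T) :
    blockLoss S b A w =
      ∑ k, ∑ j ∈ S, (w k j.succ - b k j - ∑ l, A k l * w l j.castSucc) ^ 2 := rfl

variable [IsProbabilityMeasure P]

lemma integrable_row_sq (hW : ∀ k t, MemLp (fun ω => W ω k t) 2 P) (k : Fin p) (j : Fin T)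
    (b : ℝ) (a : Fin p → ℝ) :
    Integrable (fun ω => (W ω k j.succ - b - ∑ l, a l * W ω l j.castSucc) ^ 2) P :=
  (((hW k j.succ).sub (memLp_const b)).sub (memLp_linear hW j.castSucc a)).integrable_sq

lemma risk_eq (hW : ∀ k t, MemLp (fun ω => W ω k t) 2 P) (t : ℕ) (L : Params p T) :
    risk P W t L = (p : ℝ)⁻¹ * ∑ k, (rowLoss P W (before T t) k (L.b k) (L.A k) +
      rowLoss P W (after T t) k (L.b k) (L.A' k)) := by
  rw [risk]
  simp only [sum_residual_sq, rowLoss]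
  congr 1
  rw [integral_finsetSum]
  · refine Finset.sum_congr rfl fun k _ => ?_
    rw [integral_add, integral_finsetSum, integral_finsetSum]
    all_goals intros
    all_goals try exact integrable_row_sq hW _ _ _ _
    · exact integrable_finsetSum _ fun j _ => integrable_row_sq hW _ _ _ _
    · exact integrable_finsetSum _ fun j _ => integrable_row_sq hW _ _ _ _
  · intro k _
    exact (integrable_finsetSum _ fun j _ => integrable_row_sq hW _ _ _ _).add
      (integrable_finsetSum _ fun j _ => integrable_row_sq hW _ _ _ _)

omit [IsProbabilityMeasure P] in
lemma rowLoss_congr {S : Finset (Fin T)} {k : Fin p} {b b' : Fin T → ℝ} (h : ∀ j ∈ S, b j = b' j)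
    (a : Fin p → ℝ) : rowLoss P W S k b a = rowLoss P W S k b' a :=
  Finset.sum_congr rfl fun j hj => by rw [h j hj]

/-- A minimizer of a separable sum minimizes each summand. -/
lemma le_of_forall_sum_le {ι : Type*} [Fintype ι] [DecidableEq ι] {α : Type*} {f : ι → α → ℝ}
    {x : ι → α} (h : ∀ y : ι → α, ∑ i, f i (x i) ≤ ∑ i, f i (y i)) (i : ι) (y : α) :
    f i (x i) ≤ f i y := by
  have h1 := h (Function.update x i y)
  rw [← Finset.add_sum_erase _ _ (Finset.mem_univ i),
    ← Finset.add_sum_erase _ (fun j => f j (Function.update x i y j)) (Finset.mem_univ i)] at h1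
  have h2 : ∑ j ∈ Finset.univ.erase i, f j (Function.update x i y j) =
      ∑ j ∈ Finset.univ.erase i, f j (x j) := Finset.sum_congr rfl fun j hj => by
    rw [Function.update_of_ne (Finset.ne_of_mem_erase hj)]
  rw [h2, Function.update_self] at h1
  linarith

lemma IsOptimal.rowLoss_le (hW : ∀ k t, MemLp (fun ω => W ω k t) 2 P) {t : ℕ} {L : Params p T}
    (hL : IsOptimal P W t L) (k : Fin p) (b : Fin T → ℝ) (a : Fin p → ℝ) :
    rowLoss P W (before T t) k (L.b k) (L.A k) ≤ rowLoss P W (before T t) k b a ∧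
      rowLoss P W (after T t) k (L.b k) (L.A' k) ≤ rowLoss P W (after T t) k b a := by
  have hp : 0 < p := k.pos
  have hp' : (0 : ℝ) < (p : ℝ)⁻¹ := by positivity
  have hsum := le_of_forall_sum_le
    (f := fun k (x : (Fin T → ℝ) × (Fin p → ℝ) × (Fin p → ℝ)) =>
      rowLoss P W (before T t) k x.1 x.2.1 + rowLoss P W (after T t) k x.1 x.2.2)
    (x := fun k => (L.b k, L.A k, L.A' k)) (fun y => by
      have h := hL ⟨fun k => (y k).1, fun k => (y k).2.1, fun k => (y k).2.2⟩
      rw [risk_eq hW, risk_eq hW] at h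
      exact le_of_mul_le_mul_left h hp') k
  have hmem : ∀ j, j ∈ after T t → j ∉ before T t := fun j hj hj' => by
    simp only [after, before, Finset.mem_filter] at hj hj'
    omega
  classical
  constructor
  · have h := hsum (fun j => if j ∈ before T t then b j else L.b k j, a, L.A' k)
    dsimp only at h
    rw [rowLoss_congr (b := fun j => if j ∈ before T t then b j else L.b k j) (b' := b)
      (fun j hj => if_pos hj), rowLoss_congr (S := after T t)
      (b := fun j => if j ∈ before T t then b j else L.b k j) (b' := L.b k)
      (fun j hj => if_neg (hmem j hj))] at h
    linarith
  · have h := hsum (fun j => if j ∈ before T t then L.b k j else b j, L.A k, a)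
    dsimp only at h
    rw [rowLoss_congr (b := fun j => if j ∈ before T t then L.b k j else b j) (b' := L.b k)
      (fun j hj => if_pos hj), rowLoss_congr (S := after T t)
      (b := fun j => if j ∈ before T t then L.b k j else b j) (b' := b)
      (fun j hj => if_neg (hmem j hj))] at h
    linarith

end Population

/-! ### Sample averages as integrals against uniform laws. -/

section Empirical

variable {n : ℕ}

lemma integral_uniformOn_finset (J : Finset (Fin n)) (f : Fin n → ℝ) :
    ∫ i, f i ∂(uniformOn (J : Set (Fin n))) = (J.card : ℝ)⁻¹ * ∑ i ∈ J, f i := by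
  rw [uniformOn, ProbabilityTheory.cond, integral_smul_measure, Measure.count_apply_finset,
    ENNReal.toReal_inv, ENNReal.toReal_natCast, smul_eq_mul,
    setIntegral_finset J Integrable.of_finite.integrableOn]
  simp [Measure.real]

lemma isProbabilityMeasure_uniformOn_finset {J : Finset (Fin n)} (hJ : J.Nonempty) :
    IsProbabilityMeasure (uniformOn (J : Set (Fin n))) :=
  isProbabilityMeasure_uniformOn J.finite_toSet hJ

lemma sum_eq_card_mul_integral_uniformOn {J : Finset (Fin n)} (hJ : J.Nonempty) (f : Fin n → ℝ) :
    ∑ i ∈ J, f i = J.card * ∫ i, f i ∂(uniformOn (J : Set (Fin n))) := by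
  have hc : (J.card : ℝ) ≠ 0 := by exact_mod_cast hJ.card_pos.ne'
  rw [integral_uniformOn_finset]
  field_simp

variable {p T : ℕ} {data : Fin n → Day p T}

lemma sum_blockLoss_eq {J : Finset (Fin n)} (hJ : J.Nonempty) (S : Finset (Fin T))
    (b : Matrix (Fin p) (Fin T) ℝ) (A : Matrix (Fin p) (Fin p) ℝ) :
    ∑ i ∈ J, blockLoss S b A (data i) =
      J.card * ∑ k, rowLoss (uniformOn (J : Set (Fin n))) data S k (b k) (A k) := by
  have := isProbabilityMeasure_uniformOn_finset hJ
  rw [sum_eq_card_mul_integral_uniformOn hJ]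
  simp only [blockLoss_eq, rowLoss]
  rw [integral_finsetSum _ fun _ _ => Integrable.of_finite]
  congr 1
  exact Finset.sum_congr rfl fun k _ => integral_finsetSum _ fun _ _ => Integrable.of_finite

/-- Loss and penalty both separate over rows; dividing by the sample size leaves the effective
penalty `lam / J.card`. -/
lemma rowLoss_add_penalty_le {J : Finset (Fin n)} (hJ : J.Nonempty) {S : Finset (Fin T)} {lam : ℝ}
    {b : Matrix (Fin p) (Fin T) ℝ} {A : Matrix (Fin p) (Fin p) ℝ}
    (h : ∀ b' A', lassoObjective data J S lam b A ≤ lassoObjective data J S lam b' A')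
    (k : Fin p) (b' : Fin T → ℝ) (a' : Fin p → ℝ) :
    rowLoss (uniformOn (J : Set (Fin n))) data S k (b k) (A k) +
        2 * (lam / J.card) * ∑ l, |A k l| ≤
      rowLoss (uniformOn (J : Set (Fin n))) data S k b' a' + 2 * (lam / J.card) * ∑ l, |a' l| := by
  have hc : (0 : ℝ) < J.card := by exact_mod_cast hJ.card_pos
  have hobj : ∀ (b : Matrix (Fin p) (Fin T) ℝ) (A : Matrix (Fin p) (Fin p) ℝ),
      lassoObjective data J S lam b A = J.card *
        ∑ k, (rowLoss (uniformOn (J : Set (Fin n))) data S k (b k) (A k) +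
          2 * (lam / J.card) * ∑ l, |A k l|) := fun b A => by
    rw [lassoObjective, sum_blockLoss_eq hJ, Finset.sum_add_distrib, mul_add, ← Finset.mul_sum]
    field_simp
  have hsum := le_of_forall_sum_le
    (f := fun k (x : (Fin T → ℝ) × (Fin p → ℝ)) =>
      rowLoss (uniformOn (J : Set (Fin n))) data S k x.1 x.2 +
        2 * (lam / J.card) * ∑ l, |x.2 l|)
    (x := fun k => (b k, A k)) (fun y => by
      have h1 := (hobj b A).ge.trans
        ((h (fun k => (y k).1) (fun k => (y k).2)).trans (hobj _ _).le)
      exact le_of_mul_le_mul_left h1 hc) k (b', a')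
  exact hsum

/-- Equal fold sizes make the normalization `K / (n p)` times the fold size equal to `1 / p`. -/
lemma cvRisk_eq {K : ℕ} (hK : 0 < K) (hn : 0 < n) {fold : Fin n → Fin K} (hdvd : K ∣ n)
    (hfold : ∀ κ, (foldSet fold κ).card = n / K) (est : Fin K → Params p T) (t : ℕ) :
    cvRisk data fold est t = (K : ℝ)⁻¹ * ∑ κ, (p : ℝ)⁻¹ * ∑ k,
      (rowLoss (uniformOn (foldSet fold κ : Set (Fin n))) data (before T t) k ((est κ).b k)
          ((est κ).A k) +
        rowLoss (uniformOn (foldSet fold κ : Set (Fin n))) data (after T t) k ((est κ).b k)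
          ((est κ).A' k)) := by
  rw [cvRisk]
  congr 1
  refine Finset.sum_congr rfl fun κ _ => ?_
  have hcard : 0 < n / K := Nat.div_pos (Nat.le_of_dvd hn hdvd) hK
  have hne : (foldSet fold κ).Nonempty := Finset.card_pos.1 (by rw [hfold]; exact hcard)
  rw [Finset.sum_add_distrib, sum_blockLoss_eq hne, sum_blockLoss_eq hne, ← mul_add, hfold,
    Nat.cast_div hdvd (by positivity), Finset.sum_add_distrib]
  rcases Nat.eq_zero_or_pos p with rfl | hp
  · simp
  · field_simp

end Empirical

/-! ### From moment errors to covariance errors. -/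

section Moments

variable {Ω Ω' : Type*} [MeasurableSpace Ω] [MeasurableSpace Ω']

/-- The first and second moments of two random days differ by at most `τ`. -/
def MomentsClose (μ : Measure Ω) (ν : Measure Ω') {p T : ℕ} (Z : Ω → Day p T) (Z' : Ω' → Day p T)
    (τ : ℝ) : Prop :=
  (∀ k t, |∫ ω, Z ω k t ∂μ - ∫ ω, Z' ω k t ∂ν| ≤ τ) ∧
  ∀ k t l t', |∫ ω, Z ω k t * Z ω l t' ∂μ - ∫ ω, Z' ω k t * Z' ω l t' ∂ν| ≤ τ

variable {μ : Measure Ω} {ν : Measure Ω'} [IsProbabilityMeasure μ] [IsProbabilityMeasure ν]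
  {p T : ℕ} {Z : Ω → Day p T} {Z' : Ω' → Day p T} {τ B : ℝ}

lemma MomentsClose.abs_cov_sub_le (h : MomentsClose μ ν Z Z' τ)
    (hZ : ∀ k t, MemLp (fun ω => Z ω k t) 2 μ) (hZ' : ∀ k t, MemLp (fun ω => Z' ω k t) 2 ν)
    (hB : ∀ k t, |∫ ω, Z' ω k t ∂ν| ≤ B) (hτ1 : τ ≤ 1) (k l : Fin p) (t t' : Fin (T + 1)) :
    |cov[fun ω => Z ω k t, fun ω => Z ω l t'; μ] - cov[fun ω => Z' ω k t, fun ω => Z' ω l t'; ν]| ≤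
      (2 + 2 * B) * τ := by
  rw [covariance_eq_sub (hZ k t) (hZ l t'), covariance_eq_sub (hZ' k t) (hZ' l t')]
  have h1 := h.2 k t l t'
  have h2 := h.1 k t
  have h3 := h.1 l t'
  have h4 := hB k t
  have h5 := hB l t'
  simp only [Pi.mul_apply]
  set x := ∫ ω, Z ω k t ∂μ
  set y := ∫ ω, Z ω l t' ∂μ
  set x' := ∫ ω, Z' ω k t ∂ν
  set y' := ∫ ω, Z' ω l t' ∂ν
  -- The product of the two mean errors is at most `τ ^ 2 ≤ τ`; the mixed terms cost `B * τ` each,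
  -- whence `2 + 2 * B`.
  have e : ∀ q q' : ℝ, (q - x * y) - (q' - x' * y') =
      (q - q') - ((x - x') * (y - y') + x' * (y - y') + y' * (x - x')) := fun q q' => by ring
  rw [e]
  have hτ0 : 0 ≤ τ := (abs_nonneg _).trans h2
  have hB0 : 0 ≤ B := (abs_nonneg _).trans h4
  have a1 : |(x - x') * (y - y')| ≤ 1 * τ := by
    rw [abs_mul]
    exact mul_le_mul (h2.trans hτ1) h3 (abs_nonneg _) zero_le_one
  have a2 : |x' * (y - y')| ≤ B * τ := by
    rw [abs_mul]
    exact mul_le_mul h4 h3 (abs_nonneg _) hB0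
  have a3 : |y' * (x - x')| ≤ B * τ := by
    rw [abs_mul]
    exact mul_le_mul h5 h2 (abs_nonneg _) hB0
  rw [abs_le] at *
  constructor <;> linarith

omit [MeasurableSpace Ω] [MeasurableSpace Ω'] in
lemma abs_sum_sub_sum_le {S : Finset (Fin T)} {f g : Fin T → ℝ} {δ : ℝ} (hδ : 0 ≤ δ)
    (h : ∀ j, |f j - g j| ≤ δ) : |∑ j ∈ S, f j - ∑ j ∈ S, g j| ≤ T * δ := by
  rw [← Finset.sum_sub_distrib]
  refine (Finset.abs_sum_le_sum_abs _ _).trans ?_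
  refine (Finset.sum_le_card_nsmul _ _ δ fun j _ => h j).trans ?_
  rw [nsmul_eq_mul]
  have : (S.card : ℝ) ≤ T := by
    exact_mod_cast (Finset.card_le_univ S).trans (by simp)
  exact mul_le_mul_of_nonneg_right this hδ

lemma MomentsClose.abs_sub_le (h : MomentsClose μ ν Z Z' τ)
    (hZ : ∀ k t, MemLp (fun ω => Z ω k t) 2 μ) (hZ' : ∀ k t, MemLp (fun ω => Z' ω k t) 2 ν)
    (hB0 : 0 ≤ B) (hτ0 : 0 ≤ τ)
    (hB : ∀ k t, |∫ ω, Z' ω k t ∂ν| ≤ B) (hτ1 : τ ≤ 1) (S : Finset (Fin T)) (k : Fin p) :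
    |outputVar μ Z S k - outputVar ν Z' S k| ≤ T * ((2 + 2 * B) * τ) ∧
    (∀ l, |crossCov μ Z S k l - crossCov ν Z' S k l| ≤ T * ((2 + 2 * B) * τ)) ∧
    ∀ l l', |blockCov μ Z S l l' - blockCov ν Z' S l l'| ≤ T * ((2 + 2 * B) * τ) := by
  have hδ : 0 ≤ (2 + 2 * B) * τ := by positivity
  have hc := fun l l' t t' => h.abs_cov_sub_le hZ hZ' hB hτ1 l l' t t'
  refine ⟨abs_sum_sub_sum_le hδ fun j => ?_, fun l => abs_sum_sub_sum_le hδ fun j => hc _ _ _ _,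
    fun l l' => ?_⟩
  · rw [← covariance_self (hZ k j.succ).aestronglyMeasurable.aemeasurable,
      ← covariance_self (hZ' k j.succ).aestronglyMeasurable.aemeasurable]
    exact hc _ _ _ _
  · rw [blockCov_apply, blockCov_apply]
    exact abs_sum_sub_sum_le hδ fun j => hc _ _ _ _

omit [IsProbabilityMeasure μ] [IsProbabilityMeasure ν] in
lemma MomentsClose.abs_bestIntercept_sub_le (h : MomentsClose μ ν Z Z' τ) (k : Fin p)
    (a : Fin p → ℝ) (j : Fin T) :
    |bestIntercept μ Z k a j - bestIntercept ν Z' k a j| ≤ (1 + ∑ l, |a l|) * τ := by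
  have h1 := h.1 k j.succ
  have h2 := abs_dotProduct_le (u := a)
    (v := fun l => ∫ ω, Z ω l j.castSucc ∂μ - ∫ ω, Z' ω l j.castSucc ∂ν) fun l => h.1 l j.castSucc
  simp only [dotProduct, mul_sub, Finset.sum_sub_distrib] at h2
  rw [bestIntercept, bestIntercept]
  rw [abs_le] at *
  constructor <;> linarith

end Moments

/-! ### Test loss of a Lasso row. -/

section Excess

variable {Ω₁ Ω₂ Ω : Type*} [MeasurableSpace Ω₁] [MeasurableSpace Ω₂] [MeasurableSpace Ω]
  {μ₁ : Measure Ω₁} {μ₂ : Measure Ω₂} {ν : Measure Ω} [IsProbabilityMeasure μ₁]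
  [IsProbabilityMeasure μ₂] [IsProbabilityMeasure ν]
  {p T : ℕ} {Z₁ : Ω₁ → Day p T} {Z₂ : Ω₂ → Day p T} {Z : Ω → Day p T}

/-- The loss under `μ₂` of the Lasso fit under `μ₁` is close to the optimal risk under `ν`, when
the moments of the three laws are close. -/
lemma abs_rowLoss_lasso_sub_le (hZ₁ : ∀ k t, MemLp (fun ω => Z₁ ω k t) 2 μ₁)
    (hZ₂ : ∀ k t, MemLp (fun ω => Z₂ ω k t) 2 μ₂) (hZ : ∀ k t, MemLp (fun ω => Z ω k t) 2 ν)
    {B V M γ τ₁ τ₂ lam r : ℝ} {s : ℕ} (h₁ : MomentsClose μ₁ ν Z₁ Z τ₁)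
    (h₂ : MomentsClose μ₂ ν Z₂ Z τ₂) (hB0 : 0 ≤ B) (hτ₁ : 0 ≤ τ₁) (hτ₁' : τ₁ ≤ 1) (hτ₂ : 0 ≤ τ₂)
    (hτ₂' : τ₂ ≤ 1) (hB : ∀ k t, |∫ ω, Z ω k t ∂ν| ≤ B) {S : Finset (Fin T)} {k : Fin p}
    (hV : ∀ l l', |blockCov ν Z S l l'| ≤ V) {b b' : Fin T → ℝ} {a a' : Fin p → ℝ}
    (hopt : ∀ b' a', rowLoss ν Z S k b a ≤ rowLoss ν Z S k b' a')
    (hs : (Finset.univ.filter fun l => a l ≠ 0).card ≤ s) (hM : ∑ l, |a l| ≤ M) (hγ : 0 < γ)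
    (hRE : ∀ u ∈ cone (Finset.univ.filter fun l => a l ≠ 0) 3,
      γ * ∑ l, u l ^ 2 ≤ u ⬝ᵥ (blockCov ν Z S).mulVec u)
    (hlam : 0 < lam) (hτlam : T * ((2 + 2 * B) * τ₁) * (1 + M) ≤ lam / 2)
    (hτγ : 32 * s * (T * ((2 + 2 * B) * τ₁)) ≤ γ)
    (hfit : ∀ b'' a'', rowLoss μ₁ Z₁ S k b' a' + 2 * lam * ∑ l, |a' l| ≤
      rowLoss μ₁ Z₁ S k b'' a'' + 2 * lam * ∑ l, |a'' l|)
    (hr : r = 24 * s * lam / γ) :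
    |rowLoss μ₂ Z₂ S k b' a' - rowLoss ν Z S k b a| ≤
      (1 + M + r) ^ 2 * (T * ((2 + 2 * B) * τ₂)) + r ^ 2 * V +
        T * ((1 + M + r) * (τ₁ + τ₂)) ^ 2 := by
  obtain ⟨hb, hprof⟩ := rowLoss_argmin hZ (g := fun _ => 0) (by simpa using hopt)
  obtain ⟨hb', hprof'⟩ := rowLoss_argmin hZ₁ (g := fun a => 2 * lam * ∑ l, |a l|) hfit
  simp only [add_zero] at hprof
  have hnormal := mulVec_eq_of_quadRisk_le (blockCov_isSymm S) hprof
  obtain ⟨hv₁, hc₁, hC₁⟩ := h₁.abs_sub_le hZ₁ hZ hB0 hτ₁ hB hτ₁' S k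
  obtain ⟨hv₂, hc₂, hC₂⟩ := h₂.abs_sub_le hZ₂ hZ hB0 hτ₂ hB hτ₂' S k
  have herr : ∑ l, |a' l - a l| ≤ r := by
    rw [hr]
    exact lasso_l1_error (blockCov_isSymm S) (blockCov_nonneg hZ₁ S) hnormal hc₁ hC₁ hs
      (fun i hi => by simpa using hi) hM hγ hRE hlam hτlam hτγ (by positivity) (hprof' a)
  have hr0 : 0 ≤ r := (Finset.sum_nonneg fun _ _ => abs_nonneg _).trans herr
  have ha' : ∑ l, |a' l| ≤ M + r := by
    have : ∑ l, |a' l| ≤ ∑ l, |a l| + ∑ l, |a' l - a l| := by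
      rw [← Finset.sum_add_distrib]
      refine Finset.sum_le_sum fun l _ => ?_
      have := abs_sub_abs_le_abs_sub (a' l) (a l)
      linarith
    linarith
  have hanonneg : 0 ≤ ∑ l, |a' l| := Finset.sum_nonneg fun _ _ => abs_nonneg _
  -- The error has three sources: replacing the test law by `ν` at the fitted slope, the excess risk
  -- of that slope under `ν`, and the mismatch between training and test intercepts.
  have e1 := abs_quadRisk_sub_le hv₂ hc₂ hC₂ a'
  have e2 := quadRisk_sub_eq (v := outputVar ν Z S k) (blockCov_isSymm S) hnormal a'
  have e3 := abs_quadratic_le (u := a' - a) hV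
  rw [← e2] at e3
  have hV0 : 0 ≤ V := (abs_nonneg _).trans (hV k k)
  have e4 : |profileRisk ν Z S k a' - profileRisk ν Z S k a| ≤ r ^ 2 * V := by
    refine e3.trans (mul_le_mul_of_nonneg_right ?_ hV0)
    exact pow_le_pow_left₀ (Finset.sum_nonneg fun _ _ => abs_nonneg _) herr 2
  have e5 : |profileRisk μ₂ Z₂ S k a' - profileRisk ν Z S k a'| ≤
      (1 + M + r) ^ 2 * (T * ((2 + 2 * B) * τ₂)) := by
    refine e1.trans (mul_le_mul_of_nonneg_right ?_ (by positivity))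
    exact pow_le_pow_left₀ (by linarith) (by linarith) 2
  have e6 : |∑ j ∈ S, (bestIntercept μ₂ Z₂ k a' j - b' j) ^ 2| ≤
      T * ((1 + M + r) * (τ₁ + τ₂)) ^ 2 := by
    rw [abs_of_nonneg (Finset.sum_nonneg fun _ _ => sq_nonneg _)]
    have hj : ∀ j ∈ S, (bestIntercept μ₂ Z₂ k a' j - b' j) ^ 2 ≤
        ((1 + M + r) * (τ₁ + τ₂)) ^ 2 := fun j hj => by
      rw [hb' j hj, ← sq_abs]
      refine pow_le_pow_left₀ (abs_nonneg _) ?_ 2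
      have f1 := h₁.abs_bestIntercept_sub_le k a' j
      have f2 := h₂.abs_bestIntercept_sub_le k a' j
      have f3 := abs_sub_le (bestIntercept μ₂ Z₂ k a' j) (bestIntercept ν Z k a' j)
        (bestIntercept μ₁ Z₁ k a' j)
      rw [abs_sub_comm (bestIntercept ν Z k a' j)] at f3
      have f4 : (1 + ∑ l, |a' l|) * (τ₁ + τ₂) ≤ (1 + M + r) * (τ₁ + τ₂) :=
        mul_le_mul_of_nonneg_right (by linarith) (by linarith)
      linarith
    refine (Finset.sum_le_card_nsmul _ _ _ hj).trans ?_
    rw [nsmul_eq_mul]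
    have : (S.card : ℝ) ≤ T := by exact_mod_cast (Finset.card_le_univ S).trans (by simp)
    exact mul_le_mul_of_nonneg_right this (sq_nonneg _)
  have e7 : ∑ j ∈ S, (bestIntercept ν Z k a j - b j) ^ 2 = 0 :=
    Finset.sum_eq_zero fun j hj => by rw [hb j hj]; ring
  rw [rowLoss_eq hZ₂, rowLoss_eq hZ, e7]
  rw [abs_le] at *
  constructor <;> linarith

end Excess

/-! ### Consequences of bounded data. -/

section Bounded

variable {Ω : Type*} [MeasurableSpace Ω] {P : Measure Ω} [IsProbabilityMeasure P] {p T : ℕ}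
  {W : Ω → Day p T} {B : ℝ}

lemma abs_integral_le_of_ae_bound {f : Ω → ℝ} {D : ℝ} (h : ∀ᵐ ω ∂P, |f ω| ≤ D) :
    |∫ ω, f ω ∂P| ≤ D := by
  have h' : ∀ᵐ ω ∂P, ‖f ω‖ ≤ D := h
  simpa using norm_integral_le_of_norm_le_const h'

lemma abs_integral_entry_le (hb : ∀ᵐ ω ∂P, ∀ k t, |W ω k t| ≤ B) (k : Fin p) (t : Fin (T + 1)) :
    |∫ ω, W ω k t ∂P| ≤ B :=
  abs_integral_le_of_ae_bound (hb.mono fun _ h => h k t)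

lemma abs_blockCov_le (hW : ∀ k t, MemLp (fun ω => W ω k t) 2 P) (hB : 0 ≤ B)
    (hb : ∀ᵐ ω ∂P, ∀ k t, |W ω k t| ≤ B) (S : Finset (Fin T)) (l l' : Fin p) :
    |blockCov P W S l l'| ≤ T * (2 * B ^ 2) := by
  have hj : ∀ j, |cov[fun ω => W ω l (Fin.castSucc j), fun ω => W ω l' (Fin.castSucc j); P] - 0| ≤
      2 * B ^ 2 := fun j => by
    rw [sub_zero, covariance_eq_sub (hW _ _) (hW _ _)]
    have h1 : |∫ ω, ((fun ω => W ω l j.castSucc) * fun ω => W ω l' j.castSucc) ω ∂P| ≤ B * B :=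
      abs_integral_le_of_ae_bound (hb.mono fun ω h => by
        rw [Pi.mul_apply, abs_mul]
        exact mul_le_mul (h _ _) (h _ _) (abs_nonneg _) hB)
    have h2 : |(∫ ω, W ω l j.castSucc ∂P) * ∫ ω, W ω l' j.castSucc ∂P| ≤ B * B := by
      rw [abs_mul]
      exact mul_le_mul (abs_integral_entry_le hb _ _) (abs_integral_entry_le hb _ _)
        (abs_nonneg _) hB
    refine (abs_sub _ _).trans ?_
    linarith
  have := abs_sum_sub_sum_le (S := S) (by positivity) hj
  rw [blockCov_apply]
  simpa using this

lemma outputVar_le (hW : ∀ k t, MemLp (fun ω => W ω k t) 2 P)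
    (hb : ∀ᵐ ω ∂P, ∀ k t, |W ω k t| ≤ B) (S : Finset (Fin T)) (k : Fin p) :
    outputVar P W S k ≤ T * B ^ 2 := by
  have hj : ∀ j ∈ S, Var[fun ω => W ω k (Fin.succ j); P] ≤ B ^ 2 := fun j _ => by
    refine (variance_le_expectation_sq (hW k j.succ).aestronglyMeasurable).trans ?_
    refine (le_abs_self _).trans (abs_integral_le_of_ae_bound (hb.mono fun ω h => ?_))
    rw [Pi.pow_apply, abs_pow]
    exact pow_le_pow_left₀ (abs_nonneg _) (h _ _) 2
  refine (Finset.sum_le_card_nsmul _ _ _ hj).trans ?_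
  rw [nsmul_eq_mul]
  have : (S.card : ℝ) ≤ T := by exact_mod_cast (Finset.card_le_univ S).trans (by simp)
  exact mul_le_mul_of_nonneg_right this (sq_nonneg _)

/-- A sparse optimal slope is bounded in `ℓ¹`. -/
lemma sum_abs_slope_le (hW : ∀ k t, MemLp (fun ω => W ω k t) 2 P)
    (hb : ∀ᵐ ω ∂P, ∀ k t, |W ω k t| ≤ B) {S : Finset (Fin T)} {k : Fin p} {b : Fin T → ℝ}
    {a : Fin p → ℝ} {s : ℕ} {γ : ℝ}
    (hopt : ∀ b' a', rowLoss P W S k b a ≤ rowLoss P W S k b' a')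
    (hs : (Finset.univ.filter fun l => a l ≠ 0).card ≤ s) (hγ : 0 < γ)
    (hRE : ∀ u ∈ cone (Finset.univ.filter fun l => a l ≠ 0) 3,
      γ * ∑ l, u l ^ 2 ≤ u ⬝ᵥ (blockCov P W S).mulVec u) :
    ∑ l, |a l| ≤ 1 + s * (T * B ^ 2) / γ := by
  obtain ⟨-, hprof⟩ := rowLoss_argmin hW (g := fun _ => 0) (by simpa using hopt)
  simp only [add_zero] at hprof
  have hnormal := mulVec_eq_of_quadRisk_le (blockCov_isSymm S) hprof
  -- With `C a = c` the optimal risk is `v - aᵀ C a`, so its nonnegativity bounds `aᵀ C a` by the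
  -- output variance.
  have h1 := profileRisk_nonneg hW S k a
  rw [profileRisk, quadRisk, ← hnormal] at h1
  have h2 := outputVar_le hW hb S k
  have hcompl : ∑ l ∈ (Finset.univ.filter fun l => a l ≠ 0)ᶜ, |a l| = 0 :=
    Finset.sum_eq_zero fun l hl => by
      have : a l = 0 := by simpa using hl
      simp [this]
  -- The slope lies in its own cone, being supported on its active set.
  have h3 := hRE a (by
    rw [cone, Set.mem_ofPred_eq, hcompl]
    have : 0 ≤ ∑ l with a l ≠ 0, |a l| := Finset.sum_nonneg fun _ _ => abs_nonneg _
    linarith)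
  have h4 := sq_sum_abs_le hs a
  have h5 : ∑ l with a l ≠ 0, |a l| = ∑ l, |a l| := by
    rw [← Finset.sum_add_sum_compl (Finset.univ.filter fun l => a l ≠ 0), hcompl, add_zero]
  rw [h5] at h4
  have h6 : ∑ l, a l ^ 2 ≤ T * B ^ 2 / γ := by
    rw [le_div_iff₀ hγ]
    linarith
  have h7 : (∑ l, |a l|) ^ 2 ≤ s * (T * B ^ 2) / γ := by
    rw [mul_div_assoc]
    exact h4.trans (mul_le_mul_of_nonneg_left h6 (by positivity))
  nlinarith [sq_nonneg (∑ l, |a l| - 1)]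

/-- With the optimal intercept the residual is a combination of centred entries, each at most `2 *
B`, with weights of total at most `1 + M`; conditional expectation preserves the bound on its
square. -/
lemma noiseLevel_le (hW : ∀ k t, MemLp (fun ω => W ω k t) 2 P) (hB : 0 < B)
    (hb : ∀ᵐ ω ∂P, ∀ k t, |W ω k t| ≤ B) {L : Params p T} (hL : IsOptimal P W T L) {M : ℝ}
    (hM0 : 0 ≤ M) (hM : ∀ k, ∑ l, |L.A k l| ≤ M) :
    noiseLevel P W T L ≤ 2 * B * (1 + M) := by
  refine csInf_le ⟨0, fun x hx => hx.1.le⟩ ⟨by positivity, ?_⟩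
  have hres : ∀ k j, ∀ᵐ ω ∂P, |residual T L (W ω) k j ^ 2| ≤
      (2 * B * (1 + M)) ^ 2 := fun k j => by
    obtain ⟨hint, -⟩ := rowLoss_argmin hW (g := fun _ => 0) (S := before T T) (k := k)
      (by simpa using fun b a => (hL.rowLoss_le hW k b a).1)
    have hj : j ∈ before T T := by simp only [before, Finset.mem_filter]; simp
    have hbj := hint j hj
    filter_upwards [hb] with ω hω
    have h1 : ∀ v : Fin p → ℝ, (∀ l, |v l| ≤ B) → |∑ l, L.A k l * v l| ≤ M * B := fun v hv =>
      (abs_dotProduct_le hv).trans (mul_le_mul_of_nonneg_right (hM k) hB.le)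
    have h2 := h1 (fun l => W ω l j.castSucc) fun l => hω l _
    have h3 := h1 (fun l => ∫ ω, W ω l j.castSucc ∂P) fun l => abs_integral_entry_le hb l _
    have h4 := hω k j.succ
    have h5 := abs_integral_entry_le hb k j.succ
    have h6 : residual T L (W ω) k j = W ω k j.succ -
        (bestIntercept P W k (L.A k) j + ∑ l, L.A k l * W ω l j.castSucc) := by
      simp only [residual, outputs, predict, covariates, Matrix.sub_apply, Matrix.of_apply,
        Matrix.mul_apply]
      rw [if_pos (by omega), hbj]
    rw [abs_pow, h6]
    refine pow_le_pow_left₀ (abs_nonneg _) ?_ 2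
    rw [bestIntercept]
    rw [abs_le] at *
    constructor <;> linarith
  rw [ae_all_iff]
  intro k
  rw [ae_all_iff]
  intro j
  filter_upwards [ae_bdd_abs_condExp_of_ae_bdd_abs (m := MeasurableSpace.comap
    (fun ω' (l : Fin p) => covariates (W ω') l j) inferInstance) (hres k j)] with ω hω
  exact (le_abs_self _).trans hω

omit [IsProbabilityMeasure P] in
lemma risk_nonneg (t : ℕ) (L : Params p T) : 0 ≤ risk P W t L :=
  mul_nonneg (by positivity) (integral_nonneg fun ω =>
    Finset.sum_nonneg fun _ _ => Finset.sum_nonneg fun _ _ => sq_nonneg _)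

lemma IsOptimal.risk_le (hb : ∀ᵐ ω ∂P, ∀ k t, |W ω k t| ≤ B) {t : ℕ}
    {L : Params p T} (hL : IsOptimal P W t L) : risk P W t L ≤ T * B ^ 2 := by
  refine (hL ⟨0, 0, 0⟩).trans ?_
  have h : |∫ ω, ∑ k, ∑ j, residual t (⟨0, 0, 0⟩ : Params p T) (W ω) k j ^ 2 ∂P| ≤
      p * (T * B ^ 2) := by
    refine abs_integral_le_of_ae_bound (hb.mono fun ω h => ?_)
    have e : ∀ k j, residual t (⟨0, 0, 0⟩ : Params p T) (W ω) k j = W ω k j.succ := fun k j => by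
      simp [residual, outputs, predict]
    simp only [e]
    rw [abs_of_nonneg (Finset.sum_nonneg fun _ _ => Finset.sum_nonneg fun _ _ => sq_nonneg _)]
    calc ∑ k : Fin p, ∑ j : Fin T, W ω k j.succ ^ 2
        ≤ ∑ k : Fin p, ∑ j : Fin T, B ^ 2 := by
          refine Finset.sum_le_sum fun k _ => Finset.sum_le_sum fun j _ => ?_
          rw [← sq_abs]
          exact pow_le_pow_left₀ (abs_nonneg _) (h _ _) 2
      _ = p * (T * B ^ 2) := by simp
  rw [risk]
  rcases Nat.eq_zero_or_pos p with rfl | hp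
  · simp; positivity
  · rw [inv_mul_le_iff₀ (by positivity)]
    exact (le_abs_self _).trans h

end Bounded

/-! ### Uniform concentration of empirical moments. -/

section Concentration

variable {Ω : Type*} [MeasurableSpace Ω] {P : Measure Ω} [IsProbabilityMeasure P] {n : ℕ}

/-- Hoeffding's inequality for an average over `J`, at the level `3 R √(log p / |J|)`. -/
lemma measureReal_mean_sub_ge_le {Y : Fin n → Ω → ℝ} {R e : ℝ} (hR : 0 < R)
    (hindep : iIndepFun Y P) (hY : ∀ i, AEMeasurable (Y i) P) (hbd : ∀ i, ∀ᵐ ω ∂P, |Y i ω| ≤ R)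
    (he : ∀ i, P[Y i] = e) {J : Finset (Fin n)} (hJ : J.Nonempty) {p : ℕ} (hp : 1 ≤ p) :
    P.real {ω | 3 * R * √(Real.log p / J.card) ≤ (J.card : ℝ)⁻¹ * ∑ i ∈ J, Y i ω - e} ≤
      1 / (p : ℝ) ^ 3 := by
  have hm : (0 : ℝ) < J.card := by exact_mod_cast hJ.card_pos
  have hp' : (1 : ℝ) ≤ p := by exact_mod_cast hp
  have hlog : 0 ≤ Real.log p := Real.log_nonneg hp'
  have hsub : ∀ i ∈ J, HasSubgaussianMGF (fun ω => Y i ω - e) ((‖R - -R‖₊ / 2) ^ 2) P :=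
    fun i _ => by
      have := hasSubgaussianMGF_of_mem_Icc (hY i) (a := -R) (b := R)
        ((hbd i).mono fun ω h => abs_le.1 h)
      rwa [he i] at this
  have hind : iIndepFun (fun i ω => Y i ω - e) P :=
    hindep.comp (fun _ x => x - e) fun _ => measurable_id.sub_const e
  have hmain := HasSubgaussianMGF.measure_sum_ge_le_of_iIndepFun hind hsub
    (ε := J.card * (3 * R * √(Real.log p / J.card))) (by positivity)
  have hset : {ω | 3 * R * √(Real.log p / J.card) ≤ (J.card : ℝ)⁻¹ * ∑ i ∈ J, Y i ω - e} =
      {ω | J.card * (3 * R * √(Real.log p / J.card)) ≤ ∑ i ∈ J, (Y i ω - e)} := by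
    ext ω
    simp only [Set.mem_ofPred_eq, Finset.sum_sub_distrib, Finset.sum_const, nsmul_eq_mul]
    rw [← mul_le_mul_iff_right₀ hm, mul_sub, mul_inv_cancel_left₀ hm.ne']
  rw [hset]
  refine hmain.trans ?_
  have hc : (((‖R - -R‖₊ / 2) ^ 2 : NNReal) : ℝ) = R ^ 2 := by
    push_cast
    rw [Real.norm_eq_abs, abs_of_pos (by linarith)]
    ring
  -- The factor 3 in the level yields `p ^ (-9/2)`, which is weakened to `p ^ (-3)`: still enough
  -- for a union over order `p ^ 2` moments.
  have hcoef : -(J.card * (3 * R * √(Real.log p / J.card))) ^ 2 /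
      (2 * ((∑ _i ∈ J, (‖R - -R‖₊ / 2) ^ 2 : NNReal) : ℝ)) = -(9 / 2) * Real.log p := by
    rw [NNReal.coe_sum]
    simp only [hc, Finset.sum_const, nsmul_eq_mul]
    rw [mul_pow, mul_pow, Real.sq_sqrt (by positivity)]
    field_simp
    ring
  have hexp : 1 / (p : ℝ) ^ 3 = Real.exp (-3 * Real.log p) := by
    rw [neg_mul, Real.exp_neg, one_div, mul_comm, Real.exp_mul, Real.exp_log (by linarith)]
    norm_cast
  rw [hexp]
  push_cast at hcoef ⊢
  rw [hcoef]
  exact Real.exp_le_exp.2 (by nlinarith)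

lemma measure_abs_mean_sub_gt_le {Y : Fin n → Ω → ℝ} {R e : ℝ} (hR : 0 < R)
    (hindep : iIndepFun Y P) (hY : ∀ i, AEMeasurable (Y i) P) (hbd : ∀ i, ∀ᵐ ω ∂P, |Y i ω| ≤ R)
    (he : ∀ i, P[Y i] = e) {J : Finset (Fin n)} (hJ : J.Nonempty) {p : ℕ} (hp : 1 ≤ p) :
    P {ω | ¬ |∫ i, Y i ω ∂(uniformOn (J : Set (Fin n))) - e| ≤ 3 * R * √(Real.log p / J.card)} ≤
      ENNReal.ofReal (2 / (p : ℝ) ^ 3) := by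
  have h1 := measureReal_mean_sub_ge_le hR hindep hY hbd he hJ hp
  have h2 := measureReal_mean_sub_ge_le (Y := fun i ω => -Y i ω) (e := -e) hR
    (hindep.comp (fun _ x => -x) fun _ => measurable_neg) (fun i => (hY i).neg)
    (fun i => by simpa using hbd i) (fun i => by rw [integral_neg, he i]) hJ hp
  rw [← ofReal_measureReal]
  refine ENNReal.ofReal_le_ofReal ?_
  have h3 : 2 / (p : ℝ) ^ 3 = 1 / (p : ℝ) ^ 3 + 1 / (p : ℝ) ^ 3 := by ring
  rw [h3]
  refine le_trans (measureReal_mono ?_) ((measureReal_union_le _ _).trans (add_le_add h1 h2))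
  intro ω hω
  simp only [Set.mem_ofPred_eq, not_le, Set.mem_union, integral_uniformOn_finset, lt_abs,
    Finset.sum_neg_distrib] at hω ⊢
  rcases hω with h | h
  · exact Or.inl h.le
  · exact Or.inr (by linarith)

variable {p T : ℕ} {W : Ω → Day p T} {Wobs : Fin n → Ω → Day p T} {B : ℝ}

/-- Union bound over the `p (T + 1)` entries and the squared number of their products. Since `B ≥
1`, the range `B ^ 2` serves both kinds. -/
lemma measure_not_momentsClose_le (hindep : iIndepFun Wobs P)
    (hident : ∀ i, IdentDistrib (Wobs i) W P P) (hB : 1 ≤ B)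
    (hb : ∀ᵐ ω ∂P, ∀ k t, |W ω k t| ≤ B) {J : Finset (Fin n)} (hJ : J.Nonempty) (hp : 1 ≤ p) :
    P {ω | ¬ MomentsClose (uniformOn (J : Set (Fin n))) P (fun i => Wobs i ω) W
      (3 * B ^ 2 * √(Real.log p / J.card))} ≤ ENNReal.ofReal (4 * (T + 1) ^ 2 / p) := by
  have hcore : ∀ f : Day p T → ℝ, Measurable f → (∀ᵐ ω ∂P, |f (W ω)| ≤ B ^ 2) →
      P {ω | ¬ |∫ i, f (Wobs i ω) ∂(uniformOn (J : Set (Fin n))) - ∫ ω, f (W ω) ∂P| ≤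
        3 * B ^ 2 * √(Real.log p / J.card)} ≤ ENNReal.ofReal (2 / (p : ℝ) ^ 3) := fun f hf hfb => by
    refine measure_abs_mean_sub_gt_le (Y := fun i ω => f (Wobs i ω)) (by positivity)
      (hindep.comp (fun _ => f) fun _ => hf)
      (fun i => hf.comp_aemeasurable (hident i).aemeasurable_fst) (fun i => ?_) (fun i => ?_) hJ hp
    · exact (((hident i).comp hf).symm.ae_mem_snd (t := {x | |x| ≤ B ^ 2})
        (measurableSet_le measurable_abs measurable_const) hfb)
    · exact ((hident i).comp hf).integral_eq
  have hmeas : ∀ (k : Fin p) (t : Fin (T + 1)), Measurable fun w : Day p T => w k t :=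
    fun k t => (measurable_pi_apply t).comp (measurable_pi_apply k)
  have hp0 : (0 : ℝ) < p := by exact_mod_cast hp
  have hp1 : (1 : ℝ) ≤ p := by exact_mod_cast hp
  set I := Fin p × Fin (T + 1) with hI
  have hcardI : (Fintype.card I : ℝ) = p * (T + 1) := by simp [hI]
  have hincl : {ω | ¬ MomentsClose (uniformOn (J : Set (Fin n))) P (fun i => Wobs i ω) W
      (3 * B ^ 2 * √(Real.log p / J.card))} ⊆
      (⋃ x : I, {ω | ¬ |∫ i, Wobs i ω x.1 x.2 ∂(uniformOn (J : Set (Fin n))) -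
        ∫ ω, W ω x.1 x.2 ∂P| ≤ 3 * B ^ 2 * √(Real.log p / J.card)}) ∪
      ⋃ x : I × I, {ω | ¬ |∫ i, Wobs i ω x.1.1 x.1.2 * Wobs i ω x.2.1 x.2.2
          ∂(uniformOn (J : Set (Fin n))) - ∫ ω, W ω x.1.1 x.1.2 * W ω x.2.1 x.2.2 ∂P| ≤
        3 * B ^ 2 * √(Real.log p / J.card)} := by
    intro ω hω
    by_contra hcon
    simp only [Set.mem_union, Set.mem_iUnion, Set.mem_ofPred_eq, not_or, not_exists, not_not]
      at hcon
    exact hω ⟨fun k t => hcon.1 (k, t), fun k t l t' => hcon.2 ((k, t), (l, t'))⟩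
  refine (measure_mono hincl).trans ((measure_union_le _ _).trans ?_)
  have hu1 := (measure_iUnion_fintype_le P fun x : I =>
    {ω | ¬ |∫ i, Wobs i ω x.1 x.2 ∂(uniformOn (J : Set (Fin n))) -
        ∫ ω, W ω x.1 x.2 ∂P| ≤ 3 * B ^ 2 * √(Real.log p / J.card)}).trans
    (Finset.sum_le_card_nsmul _ _ _ fun x _ => hcore (fun w => w x.1 x.2) (hmeas _ _)
      (hb.mono fun ω h => (h _ _).trans (by nlinarith)))
  have hu2 := (measure_iUnion_fintype_le P fun x : I × I =>
    {ω | ¬ |∫ i, Wobs i ω x.1.1 x.1.2 * Wobs i ω x.2.1 x.2.2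
          ∂(uniformOn (J : Set (Fin n))) - ∫ ω, W ω x.1.1 x.1.2 * W ω x.2.1 x.2.2 ∂P| ≤
        3 * B ^ 2 * √(Real.log p / J.card)}).trans
    (Finset.sum_le_card_nsmul _ _ _ fun x _ => hcore
      (fun w => w x.1.1 x.1.2 * w x.2.1 x.2.2) ((hmeas _ _).mul (hmeas _ _))
      (hb.mono fun ω h => by
        rw [abs_mul, sq]
        exact mul_le_mul (h _ _) (h _ _) (abs_nonneg _) (by linarith)))
  refine (add_le_add hu1 hu2).trans ?_
  rw [← ENNReal.ofReal_nsmul, ← ENNReal.ofReal_nsmul, ← ENNReal.ofReal_add (by positivity)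
    (by positivity)]
  refine ENNReal.ofReal_le_ofReal ?_
  simp only [nsmul_eq_mul, Finset.card_univ, Fintype.card_prod I I, Nat.cast_mul, hcardI]
  have hN : (p : ℝ) * (T + 1) ≤ p * (T + 1) * (p * (T + 1)) := by
    have : (1 : ℝ) ≤ p * (T + 1) := one_le_mul_of_one_le_of_one_le hp1 (by
      have : (0 : ℝ) ≤ T := by positivity
      linarith)
    nlinarith
  have h2 : (0 : ℝ) ≤ 2 / (p : ℝ) ^ 3 := by positivity
  calc (p : ℝ) * (T + 1) * (2 / (p : ℝ) ^ 3) + p * (T + 1) * (p * (T + 1)) * (2 / (p : ℝ) ^ 3)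
      ≤ (p : ℝ) * (T + 1) * (p * (T + 1)) * (2 / (p : ℝ) ^ 3) +
        p * (T + 1) * (p * (T + 1)) * (2 / (p : ℝ) ^ 3) := by gcongr
    _ = 4 * ((T : ℝ) + 1) ^ 2 / p := by field_simp; ring

end Concentration

/-! ### Cross-validated risk against optimal risk. -/

lemma abs_mean_sub_mean_le {m : ℕ} {x y : Fin m → ℝ} {d : ℝ} (hm : 0 < m)
    (h : ∀ i, |x i - y i| ≤ d) : |(m : ℝ)⁻¹ * ∑ i, x i - (m : ℝ)⁻¹ * ∑ i, y i| ≤ d := by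
  have hm' : (0 : ℝ) < m := by exact_mod_cast hm
  rw [← mul_sub, ← Finset.sum_sub_distrib, abs_mul, abs_of_pos (by positivity),
    inv_mul_le_iff₀ hm']
  refine (Finset.abs_sum_le_sum_abs _ _).trans
    ((Finset.sum_le_card_nsmul _ _ d fun i _ => h i).trans ?_)
  simp

/-- The bound on the difference between the cross-validated and the optimal loss of a row, when
the Lasso error is `r` and the training and test moments are accurate up to `τ₁` and `τ₂`. -/
noncomputable def rowDev (T : ℕ) (B M r τ₁ τ₂ : ℝ) : ℝ :=
  (1 + M + r) ^ 2 * (T * ((2 + 2 * B) * τ₂)) + r ^ 2 * (T * (2 * B ^ 2)) +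
    T * ((1 + M + r) * (τ₁ + τ₂)) ^ 2

section CrossValidation

variable {Ω : Type*} [MeasurableSpace Ω] {P : Measure Ω} [IsProbabilityMeasure P]
  {n p T K : ℕ} {W : Ω → Day p T} {data : Fin n → Day p T}

/-- The cross-validated risk is close to the optimal risk when the empirical moments on the folds
and on their complements are accurate. -/
lemma abs_cvRisk_sub_risk_le (hW : ∀ k t, MemLp (fun ω => W ω k t) 2 P) {B : ℝ} (hB : 1 ≤ B)
    (hb : ∀ᵐ ω ∂P, ∀ k t, |W ω k t| ≤ B) {t : ℕ} (ht : t ≤ T) {L : Params p T}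
    (hL : IsOptimal P W t L) {s : ℕ}
    (hs : ∀ k, (activeSet L.A k).card ≤ s ∧ (t < T → (activeSet L.A' k).card ≤ s)) {γ : ℝ}
    (hγ : 0 < γ) (hRE : RestrictedEigenvalue (blockCov P W (before T t)) L.A γ ∧
      (t < T → RestrictedEigenvalue (blockCov P W (after T t)) L.A' γ))
    (hK : 2 ≤ K) (hn : 0 < n) (hp : 0 < p) {fold : Fin n → Fin K} (hdvd : K ∣ n)
    (hfold : ∀ κ, (foldSet fold κ).card = n / K) {est : Fin K → Params p T} {lam : ℝ}
    (hest : ∀ κ, IsLassoFit data (foldSet fold κ)ᶜ lam t (est κ)) {M r τ₁ τ₂ : ℝ}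
    (hM : M = 1 + s * (T * B ^ 2) / γ)
    (hclose : ∀ κ, MomentsClose (uniformOn (foldSet fold κ : Set (Fin n))) P data W τ₂ ∧
      MomentsClose (uniformOn (((foldSet fold κ)ᶜ : Finset (Fin n)) : Set (Fin n))) P data W τ₁)
    (hτ₁ : 0 ≤ τ₁) (hτ₁' : τ₁ ≤ 1) (hτ₂ : 0 ≤ τ₂) (hτ₂' : τ₂ ≤ 1)
    (hlam : 0 < lam)
    (hτlam : T * ((2 + 2 * B) * τ₁) * (1 + M) ≤ lam / ((n - n / K : ℕ) : ℝ) / 2)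
    (hτγ : 32 * s * (T * ((2 + 2 * B) * τ₁)) ≤ γ)
    (hr : r = 24 * s * (lam / ((n - n / K : ℕ) : ℝ)) / γ) :
    |cvRisk data fold est t - risk P W t L| ≤ 2 * rowDev T B M r τ₁ τ₂ := by
  have hB0 : 0 ≤ B := by linarith
  have hcard : 0 < n / K := Nat.div_pos (Nat.le_of_dvd hn hdvd) (by omega)
  have hcard' : 0 < n - n / K := Nat.sub_pos_of_lt (Nat.div_lt_self hn (by omega))
  have hcompl : ∀ κ, (foldSet fold κ)ᶜ.card = n - n / K := fun κ => by
    rw [Finset.card_compl, hfold, Fintype.card_fin]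
  have hne : ∀ κ, (foldSet fold κ).Nonempty := fun κ =>
    Finset.card_pos.1 (by rw [hfold]; exact hcard)
  have hne' : ∀ κ, (foldSet fold κ)ᶜ.Nonempty := fun κ =>
    Finset.card_pos.1 (by rw [hcompl]; exact hcard')
  have hcr : (0 : ℝ) < ((n - n / K : ℕ) : ℝ) := by exact_mod_cast hcard'
  have hM0 : 0 ≤ M := by rw [hM]; positivity
  have hr0 : 0 ≤ r := by rw [hr]; positivity
  have key : ∀ (S : Finset (Fin T)) (A : Matrix (Fin p) (Fin p) ℝ) (κ : Fin K) (k : Fin p)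
      (A' : Matrix (Fin p) (Fin p) ℝ),
      (∀ b' a', rowLoss P W S k (L.b k) (A k) ≤ rowLoss P W S k b' a') →
      (activeSet A k).card ≤ s → RestrictedEigenvalue (blockCov P W S) A γ →
      (∀ b'' A'', lassoObjective data (foldSet fold κ)ᶜ S lam (est κ).b A' ≤
        lassoObjective data (foldSet fold κ)ᶜ S lam b'' A'') →
      |rowLoss (uniformOn (foldSet fold κ : Set (Fin n))) data S k ((est κ).b k) (A' k) -
        rowLoss P W S k (L.b k) (A k)| ≤ rowDev T B M r τ₁ τ₂ := by
    intro S A κ k A' hopt hsk hREk hfit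
    have := isProbabilityMeasure_uniformOn_finset (hne κ)
    have := isProbabilityMeasure_uniformOn_finset (hne' κ)
    have hfit' := rowLoss_add_penalty_le (hne' κ) hfit k
    rw [hcompl] at hfit'
    exact abs_rowLoss_lasso_sub_le (fun _ _ => MemLp.of_discrete) (fun _ _ => MemLp.of_discrete) hW
      (hclose κ).2 (hclose κ).1 hB0 hτ₁ hτ₁' hτ₂ hτ₂' (abs_integral_entry_le hb)
      (abs_blockCov_le hW hB0 hb S) hopt hsk
      ((sum_abs_slope_le hW hb hopt hsk hγ (hREk k)).trans_eq hM.symm) hγ (hREk k)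
      (by positivity) hτlam hτγ hfit' hr
  have hdev0 : 0 ≤ rowDev T B M r τ₁ τ₂ := by
    rw [rowDev]; positivity
  rw [cvRisk_eq (by omega) hn hdvd hfold, risk_eq hW]
  have hconst : ∀ x : ℝ, x = (K : ℝ)⁻¹ * ∑ _κ : Fin K, x := fun x => by
    have : (K : ℝ) ≠ 0 := by positivity
    simp only [Finset.sum_const, Finset.card_univ, Fintype.card_fin, nsmul_eq_mul]
    field_simp
  -- The risk is written as a constant average over folds, so that both sides are averages over
  -- folds and rows and can be compared termwise.
  rw [hconst ((p : ℝ)⁻¹ * _)]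
  refine abs_mean_sub_mean_le (by omega) fun κ => abs_mean_sub_mean_le hp fun k => ?_
  have h1 := key (before T t) L.A κ k (est κ).A (fun b a => (hL.rowLoss_le hW k b a).1) (hs k).1
    hRE.1 (hest κ).1
  have h2 : |rowLoss (uniformOn (foldSet fold κ : Set (Fin n))) data (after T t) k ((est κ).b k)
      ((est κ).A' k) - rowLoss P W (after T t) k (L.b k) (L.A' k)| ≤ rowDev T B M r τ₁ τ₂ := by
    rcases ht.lt_or_eq with hlt | heq
    · exact key (after T t) L.A' κ k (est κ).A' (fun b a => (hL.rowLoss_le hW k b a).2)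
        ((hs k).2 hlt) (hRE.2 hlt) (hest κ).2
    -- For `t = T` the second period is empty and `A'` is arbitrary, but both losses are zero.
    · have hempty : after T t = ∅ := by
        rw [after, Finset.filter_eq_empty_iff]
        intro j _
        omega
      simpa [hempty, rowLoss] using hdev0
  rw [abs_le] at *
  constructor <;> linarith

variable {Wobs : Fin n → Ω → Day p T}

/-- The empirical moments on all the folds and their complements are accurate with high
probability. -/
lemma measure_not_forall_momentsClose_le (hindep : iIndepFun Wobs P)
    (hident : ∀ i, IdentDistrib (Wobs i) W P P) {B : ℝ} (hB : 1 ≤ B)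
    (hb : ∀ᵐ ω ∂P, ∀ k t, |W ω k t| ≤ B) (hK : 2 ≤ K) (hn : 0 < n) (hp : 1 ≤ p)
    {fold : Fin n → Fin K} (hdvd : K ∣ n) (hfold : ∀ κ, (foldSet fold κ).card = n / K) :
    P {ω | ¬ ∀ κ, MomentsClose (uniformOn (foldSet fold κ : Set (Fin n))) P
        (fun i => Wobs i ω) W (3 * B ^ 2 * √(Real.log p / ((n / K : ℕ) : ℝ))) ∧
      MomentsClose (uniformOn (((foldSet fold κ)ᶜ : Finset (Fin n)) : Set (Fin n))) P
        (fun i => Wobs i ω) W (3 * B ^ 2 * √(Real.log p / ((n - n / K : ℕ) : ℝ)))} ≤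
      K * (2 * ENNReal.ofReal (4 * (T + 1) ^ 2 / p)) := by
  have hcard : 0 < n / K := Nat.div_pos (Nat.le_of_dvd hn hdvd) (by omega)
  have hcard' : 0 < n - n / K := Nat.sub_pos_of_lt (Nat.div_lt_self hn (by omega))
  have hcompl : ∀ κ, (foldSet fold κ)ᶜ.card = n - n / K := fun κ => by
    rw [Finset.card_compl, hfold, Fintype.card_fin]
  have h1 := fun κ => measure_not_momentsClose_le hindep hident hB hb
    (Finset.card_pos.1 (by rw [hfold κ]; exact hcard)) hp
  have h2 := fun κ => measure_not_momentsClose_le hindep hident hB hb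
    (Finset.card_pos.1 (by rw [hcompl κ]; exact hcard')) hp
  simp only [hfold, hcompl] at h1 h2
  have hset := measure_iUnion_fintype_le P fun κ : Fin K =>
    {ω | ¬ MomentsClose (uniformOn (foldSet fold κ : Set (Fin n))) P
      (fun i => Wobs i ω) W (3 * B ^ 2 * √(Real.log p / ((n / K : ℕ) : ℝ)))} ∪
    {ω | ¬ MomentsClose (uniformOn (((foldSet fold κ)ᶜ : Finset (Fin n)) : Set (Fin n))) P
      (fun i => Wobs i ω) W (3 * B ^ 2 * √(Real.log p / ((n - n / K : ℕ) : ℝ)))}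
  refine (measure_mono fun ω hω => ?_).trans (hset.trans ((Finset.sum_le_card_nsmul _ _
    (2 * ENNReal.ofReal (4 * (T + 1) ^ 2 / p)) fun κ _ => ?_).trans ?_))
  · simp only [Set.mem_ofPred_eq, not_forall, not_and_or] at hω
    simpa only [Set.mem_iUnion, Set.mem_union, Set.mem_ofPred_eq] using hω
  · rw [two_mul]
    exact (measure_union_le _ _).trans (add_le_add (h1 κ) (h2 κ))
  · simp

end CrossValidation

/-! ### Rates along the multiples of `K`. -/

section Rates

variable {p : ℕ → ℕ} {K : ℕ}

lemma tendsto_sqrt_log_div_fold (hlog : Tendsto (fun n : ℕ => Real.log (p n) / n) atTop (𝓝 0))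
    (hK : 2 ≤ K) :
    Tendsto (fun n : ℕ => √(Real.log (p n) / ((n / K : ℕ) : ℝ))) (atTop ⊓ 𝓟 {n | K ∣ n}) (𝓝 0) := by
  have hK0 : (K : ℝ) ≠ 0 := by positivity
  have h := ((hlog.const_mul (K : ℝ)).sqrt).mono_left (inf_le_left (b := 𝓟 {n | K ∣ n}))
  rw [mul_zero, Real.sqrt_zero] at h
  refine h.congr' (eventually_inf_principal.2 (Eventually.of_forall fun n hn => ?_))
  dsimp only
  rw [Nat.cast_div hn hK0]
  congr 1
  field_simp

lemma cast_sub_div_eq (hK : 2 ≤ K) {n : ℕ} (hn : K ∣ n) :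
    ((n - n / K : ℕ) : ℝ) = n * (1 - (K : ℝ)⁻¹) := by
  have hK0 : (K : ℝ) ≠ 0 := by positivity
  rw [Nat.cast_sub (Nat.div_le_self n K), Nat.cast_div hn hK0]
  ring

lemma one_sub_inv_pos (hK : 2 ≤ K) : (0 : ℝ) < 1 - (K : ℝ)⁻¹ := by
  have : (2 : ℝ) ≤ K := by exact_mod_cast hK
  have : (K : ℝ)⁻¹ < 1 := inv_lt_one_of_one_lt₀ (by linarith)
  linarith

lemma tendsto_sqrt_log_div_compl (hlog : Tendsto (fun n : ℕ => Real.log (p n) / n) atTop (𝓝 0))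
    (hK : 2 ≤ K) :
    Tendsto (fun n : ℕ => √(Real.log (p n) / ((n - n / K : ℕ) : ℝ))) (atTop ⊓ 𝓟 {n | K ∣ n})
      (𝓝 0) := by
  have h := ((hlog.const_mul (1 - (K : ℝ)⁻¹)⁻¹).sqrt).mono_left
    (inf_le_left (b := 𝓟 {n | K ∣ n}))
  rw [mul_zero, Real.sqrt_zero] at h
  refine h.congr' (eventually_inf_principal.2 (Eventually.of_forall fun n hn => ?_))
  have := one_sub_inv_pos hK
  dsimp only
  rw [cast_sub_div_eq hK hn]
  congr 1
  rw [inv_mul_eq_div, div_div]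

/-- The square root equals `σ n * n * √(log p / n)` and the training size is `n * (1 - 1 / K)`, so a
bounded noise level suffices. -/
lemma tendsto_penalty_div (hlog : Tendsto (fun n : ℕ => Real.log (p n) / n) atTop (𝓝 0))
    (hK : 2 ≤ K) {σ : ℕ → ℝ} {D : ℝ} (hσ0 : ∀ᶠ n in atTop, 0 ≤ σ n) (hσ : ∀ᶠ n in atTop, σ n ≤ D)
    {C : ℝ} (hC : 0 ≤ C) :
    Tendsto (fun n : ℕ => C * √(n * σ n ^ 2 * Real.log (p n)) / ((n - n / K : ℕ) : ℝ))
      (atTop ⊓ 𝓟 {n | K ∣ n}) (𝓝 0) := by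
  have hq := one_sub_inv_pos hK
  have h := (((hlog.sqrt.const_mul (C * D)).div_const (1 - (K : ℝ)⁻¹))).mono_left
    (inf_le_left (b := 𝓟 {n | K ∣ n}))
  rw [Real.sqrt_zero, mul_zero, zero_div] at h
  refine squeeze_zero' (Eventually.of_forall fun n => by positivity) ?_ h
  rw [eventually_inf_principal]
  filter_upwards [hσ0, hσ, eventually_gt_atTop 0] with n h0 h1 hn hdvd
  have hn' : (0 : ℝ) < n := by exact_mod_cast hn
  have hl : 0 ≤ Real.log (p n) := Real.log_natCast_nonneg _
  have e : √(n * σ n ^ 2 * Real.log (p n)) = σ n * (n * √(Real.log (p n) / n)) := by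
    rw [show n * σ n ^ 2 * Real.log (p n) = (σ n * n) ^ 2 * (Real.log (p n) / n) by field_simp,
      Real.sqrt_mul (by positivity), Real.sqrt_sq (by positivity)]
    ring
  rw [cast_sub_div_eq hK hdvd, e, ← div_div]
  refine div_le_div_of_nonneg_right ?_ hq.le
  rw [div_le_iff₀ hn']
  have : C * σ n * (n * √(Real.log (p n) / n)) ≤ C * D * (n * √(Real.log (p n) / n)) := by
    gcongr
  linarith

/-- As `m ≤ n` and `c ≤ σ`, the effective penalty is at least `C * c` times the training rate;
comparing it with the moment errors becomes a condition on `C` alone. -/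
lemma le_penalty_div {n m q : ℕ} (hm : 0 < m) (hmn : m ≤ n) {σ c C : ℝ} (hc : 0 ≤ c) (hσ : c ≤ σ)
    (hC : 0 ≤ C) :
    C * (c * √(Real.log q / m)) ≤ C * √(n * σ ^ 2 * Real.log q) / m := by
  have hm' : (0 : ℝ) < m := by exact_mod_cast hm
  have hmn' : (m : ℝ) ≤ n := by exact_mod_cast hmn
  have hl : 0 ≤ Real.log q := Real.log_natCast_nonneg _
  rw [mul_div_assoc]
  refine mul_le_mul_of_nonneg_left ?_ hC
  rw [le_div_iff₀ hm']
  refine Real.le_sqrt_of_sq_le ?_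
  rw [mul_pow, mul_pow, Real.sq_sqrt (by positivity)]
  have e : c ^ 2 * (Real.log q / m) * (m : ℝ) ^ 2 = m * c ^ 2 * Real.log q := by field_simp
  rw [e]
  gcongr

lemma tendsto_rowDev {ι : Type*} {l : Filter ι} {T : ℕ} {B M : ℝ} {r τ₁ τ₂ : ι → ℝ}
    (hr : Tendsto r l (𝓝 0)) (h₁ : Tendsto τ₁ l (𝓝 0)) (h₂ : Tendsto τ₂ l (𝓝 0)) :
    Tendsto (fun i => rowDev T B M (r i) (τ₁ i) (τ₂ i)) l (𝓝 0) := by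
  have hc : Continuous fun x : ℝ × ℝ × ℝ => rowDev T B M x.1 x.2.1 x.2.2 := by
    unfold rowDev
    fun_prop
  have h := (hc.tendsto (0, 0, 0)).comp (hr.prodMk_nhds (h₁.prodMk_nhds h₂))
  have h0 : rowDev T B M 0 0 0 = 0 := by simp [rowDev]
  rw [h0] at h
  exact h

end Rates

end RegimeSwitch

/-! ### Consistency of the selected change point. -/

theorem corollary4p2 {Ω : Type*} [MeasurableSpace Ω] (P : Measure Ω) [IsProbabilityMeasure P]
    (T : ℕ) (hT : 2 ≤ T)
    (p : ℕ → ℕ) (hp : Tendsto p atTop atTop)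
    (hlog : Tendsto (fun n : ℕ => Real.log (p n) / n) atTop (𝓝 0))
    -- the generic day, and the `n` observed days, for each `n`
    (W : (n : ℕ) → Ω → RegimeSwitch.Day (p n) T)
    (Wobs : (n : ℕ) → Fin n → Ω → RegimeSwitch.Day (p n) T)
    (hW : ∀ n, Measurable (W n))
    (hW2 : ∀ n k t, MemLp (fun ω => W n ω k t) 2 P)
    (hindep : ∀ n, iIndepFun (Wobs n) P)
    (hident : ∀ n i, IdentDistrib (Wobs n i) (W n) P P)
    (hbdd : ∃ B : ℝ, ∀ᶠ n in atTop, ∀ᵐ ω ∂P, ∀ k t, |W n ω k t| ≤ B)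
    -- the optimal predictor of each submodel
    (Lstar : (n : ℕ) → ℕ → RegimeSwitch.Params (p n) T)
    (hLstar : ∀ n, ∀ t ∈ Finset.Icc 1 T, RegimeSwitch.IsOptimal P (W n) t (Lstar n t))
    (hnoise : ∃ c > 0, ∀ᶠ n in atTop, c ≤ RegimeSwitch.noiseLevel P (W n) T (Lstar n T))
    (hsparse : ∃ s : ℕ, ∀ᶠ n in atTop, ∀ t ∈ Finset.Icc 1 T, ∀ k,
      (RegimeSwitch.activeSet (Lstar n t).A k).card ≤ s ∧
      (t < T → (RegimeSwitch.activeSet (Lstar n t).A' k).card ≤ s))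
    (hRE : ∃ γ > 0, ∀ᶠ n in atTop, ∀ t ∈ Finset.Icc 1 T,
      RegimeSwitch.RestrictedEigenvalue
        (RegimeSwitch.blockCov P (W n) (RegimeSwitch.before T t)) (Lstar n t).A γ ∧
      (t < T → RegimeSwitch.RestrictedEigenvalue
        (RegimeSwitch.blockCov P (W n) (RegimeSwitch.after T t)) (Lstar n t).A' γ))
    (tstar : ℕ) (htstar : tstar ∈ Finset.Icc 1 (T - 1))
    (hsep : ∀ t ∈ Finset.Icc 1 T, t ≠ tstar →
      limsup (fun n => RegimeSwitch.risk P (W n) tstar (Lstar n tstar)) atTop <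
        liminf (fun n => RegimeSwitch.risk P (W n) t (Lstar n t)) atTop) :
    ∃ C₀ > 0, ∀ C ≥ C₀,
      -- the number of folds, and the partition of the `n` days into folds of equal size
      ∀ (K : ℕ), 2 ≤ K → ∀ (fold : (n : ℕ) → Fin n → Fin K),
      (∀ n, K ∣ n → ∀ κ, (RegimeSwitch.foldSet (fold n) κ).card = n / K) →
      -- the Lasso estimates without each fold `κ`, for each change point `t`
      ∀ (est : (n : ℕ) → Ω → ℕ → Fin K → RegimeSwitch.Params (p n) T),
      (∀ n, 0 < n → K ∣ n → ∀ ω, ∀ t ∈ Finset.Icc 1 T, ∀ κ,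
        RegimeSwitch.IsLassoFit (fun i => Wobs n i ω) (RegimeSwitch.foldSet (fold n) κ)ᶜ
          (C * √(n * RegimeSwitch.noiseLevel P (W n) T (Lstar n T) ^ 2 * Real.log (p n))) t
          (est n ω t κ)) →
      -- the cross-validation estimate of the change point
      ∀ (that : ℕ → Ω → ℕ), (∀ n, AEMeasurable (that n) P) →
      (∀ n, 0 < n → K ∣ n → ∀ ω, that n ω ∈ Finset.Icc 1 T ∧ ∀ t ∈ Finset.Icc 1 T,
        RegimeSwitch.cvRisk (fun i => Wobs n i ω) (fold n) (est n ω (that n ω)) (that n ω) ≤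
          RegimeSwitch.cvRisk (fun i => Wobs n i ω) (fold n) (est n ω t) t) →
      Tendsto (fun n => P {ω | that n ω = tstar}) (atTop ⊓ 𝓟 {n | K ∣ n}) (𝓝 1) := by
  open RegimeSwitch in
  obtain ⟨B₀, hB₀⟩ := hbdd
  obtain ⟨c, hc, hnoise⟩ := hnoise
  obtain ⟨s, hsparse⟩ := hsparse
  obtain ⟨γ, hγ, hRE⟩ := hRE
  obtain ⟨B, hB, hb⟩ : ∃ B : ℝ, 1 ≤ B ∧ ∀ᶠ n in atTop, ∀ᵐ ω ∂P, ∀ k t, |W n ω k t| ≤ B :=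
    ⟨max B₀ 1, le_max_right _ _, hB₀.mono fun n h => h.mono fun ω h' k t =>
      (h' k t).trans (le_max_left _ _)⟩
  set M : ℝ := 1 + s * (T * B ^ 2) / γ with hM
  have hT0 : (0 : ℝ) < T := by
    have : 0 < T := by omega
    exact_mod_cast this
  have hB0 : 0 < B := by linarith
  have hM0 : 0 ≤ M := by positivity
  set σ : ℕ → ℝ := fun n => noiseLevel P (W n) T (Lstar n T) with hσdef
  have hp2 : ∀ᶠ n in atTop, 2 ≤ p n := hp.eventually_ge_atTop 2
  have hTT : T ∈ Finset.Icc 1 T := Finset.mem_Icc.2 ⟨by omega, le_rfl⟩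
  have hσ : ∀ᶠ n in atTop, σ n ≤ 2 * B * (1 + M) := by
    filter_upwards [hb, hsparse, hRE] with n h1 h2 h3
    exact noiseLevel_le (hW2 n) hB0 h1 (hLstar n T hTT) hM0 fun k =>
      sum_abs_slope_le (hW2 n) h1 (fun b a => ((hLstar n T hTT).rowLoss_le (hW2 n) k b a).1)
        (h2 T hTT k).1 hγ ((h3 T hTT).1 k)
  have hgap : ∀ t ∈ Finset.Icc 1 T, t ≠ tstar → ∃ ε > 0, ∀ᶠ n in atTop,
      risk P (W n) tstar (Lstar n tstar) + ε < risk P (W n) t (Lstar n t) := by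
    intro t ht hne
    have htstar' : tstar ∈ Finset.Icc 1 T := by
      rw [Finset.mem_Icc] at htstar ⊢
      omega
    obtain ⟨r₁, h1, h2⟩ := exists_between (hsep t ht hne)
    obtain ⟨r₂, h3, h4⟩ := exists_between h2
    -- Real `limsup` and `liminf` have default values on unbounded sequences, so boundedness is
    -- needed to extract eventual inequalities.
    have hup : IsBoundedUnder (· ≤ ·) atTop fun n => risk P (W n) tstar (Lstar n tstar) :=
      ⟨T * B ^ 2, eventually_map.2 (hb.mono fun n h => (hLstar n tstar htstar').risk_le h)⟩
    have hlow : IsBoundedUnder (· ≥ ·) atTop fun n => risk P (W n) t (Lstar n t) :=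
      ⟨0, eventually_map.2 (Eventually.of_forall fun n => risk_nonneg _ _)⟩
    refine ⟨r₂ - r₁, sub_pos.2 h3, ?_⟩
    filter_upwards [eventually_lt_of_limsup_lt h1 hup, eventually_lt_of_lt_liminf h4 hlow]
      with n h5 h6
    linarith
  -- Chosen so that `C * c` is at least twice the factor multiplying `√(log p / |J|)` in the
  -- gradient deviation; it does not depend on `K`.
  refine ⟨T * ((2 + 2 * B) * (3 * B ^ 2)) * (1 + M) * 2 / c, by positivity, ?_⟩
  intro C hC K hK fold hfold est hest that _ hthat
  have hC0 : 0 < C := lt_of_lt_of_le (by positivity) hC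
  set l : Filter ℕ := atTop ⊓ 𝓟 {n | K ∣ n} with hl
  have hle : l ≤ atTop := inf_le_left
  set τ₁ : ℕ → ℝ := fun n => 3 * B ^ 2 * √(Real.log (p n) / ((n - n / K : ℕ) : ℝ)) with hτ₁
  set τ₂ : ℕ → ℝ := fun n => 3 * B ^ 2 * √(Real.log (p n) / ((n / K : ℕ) : ℝ)) with hτ₂
  set lam : ℕ → ℝ := fun n => C * √(n * σ n ^ 2 * Real.log (p n)) with hlamdef
  set r : ℕ → ℝ := fun n => 24 * s * (lam n / ((n - n / K : ℕ) : ℝ)) / γ with hr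
  have hτ₁0 : Tendsto τ₁ l (𝓝 0) := by
    have h := (tendsto_sqrt_log_div_compl hlog hK).const_mul (3 * B ^ 2)
    rwa [mul_zero] at h
  have hτ₂0 : Tendsto τ₂ l (𝓝 0) := by
    have h := (tendsto_sqrt_log_div_fold hlog hK).const_mul (3 * B ^ 2)
    rwa [mul_zero] at h
  have hr0 : Tendsto r l (𝓝 0) := by
    simpa using ((tendsto_penalty_div hlog hK (hnoise.mono fun n h => hc.le.trans h) hσ
      hC0.le).const_mul (24 * (s : ℝ))).div_const γ
  -- Each of the two compared cross-validated risks may be off by `2 * rowDev`.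
  have hdev : Tendsto (fun n => 4 * rowDev T B M (r n) (τ₁ n) (τ₂ n)) l (𝓝 0) := by
    simpa using (tendsto_rowDev (T := T) (B := B) (M := M) hr0 hτ₁0 hτ₂0).const_mul 4
  have hgap' : ∀ᶠ n in l, ∀ t ∈ Finset.Icc 1 T, t ≠ tstar →
      risk P (W n) tstar (Lstar n tstar) + 4 * rowDev T B M (r n) (τ₁ n) (τ₂ n) <
        risk P (W n) t (Lstar n t) := by
    rw [Filter.eventually_all_finset]
    intro t ht
    by_cases hne : t = tstar
    · exact Eventually.of_forall fun n h => absurd hne h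
    · obtain ⟨ε, hε, h⟩ := hgap t ht hne
      filter_upwards [h.filter_mono hle, hdev.eventually_lt_const hε] with n h1 h2 _
      linarith
  have hτγ : ∀ᶠ n in l, 32 * s * (T * ((2 + 2 * B) * τ₁ n)) ≤ γ := by
    have h := ((hτ₁0.const_mul (2 + 2 * B)).const_mul (T : ℝ)).const_mul (32 * (s : ℝ))
    simp only [mul_zero] at h
    exact h.eventually_le_const hγ
  -- The subtraction in `ENNReal` is truncated, so the bound is merely trivial for small `p n`.
  have hbad : ∀ᶠ n in l, 1 - K * (2 * ENNReal.ofReal (4 * (T + 1) ^ 2 / p n)) ≤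
      P {ω | that n ω = tstar} := by
    filter_upwards [hb.filter_mono hle, hsparse.filter_mono hle, hRE.filter_mono hle,
      hnoise.filter_mono hle, hp2.filter_mono hle, (eventually_gt_atTop 0).filter_mono hle,
      hgap', hτγ, hτ₁0.eventually_le_const one_pos, hτ₂0.eventually_le_const one_pos,
      mem_inf_of_right (mem_principal_self _)]
      with n hbn hsn hREn hσn hpn hn hgapn hτγn hτ₁n hτ₂n hdvd
    have hdvd' : K ∣ n := hdvd
    have hcard' : 0 < n - n / K := Nat.sub_pos_of_lt (Nat.div_lt_self hn (by omega))
    have hcr : (0 : ℝ) < ((n - n / K : ℕ) : ℝ) := by exact_mod_cast hcard'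
    have hn' : (0 : ℝ) < n := by exact_mod_cast hn
    have hlogp : 0 < Real.log (p n) := Real.log_pos (by exact_mod_cast hpn)
    have hσ0 : 0 < σ n := hc.trans_le hσn
    have hlam : 0 < lam n := by
      rw [hlamdef]
      positivity
    have hτlam : T * ((2 + 2 * B) * τ₁ n) * (1 + M) ≤
        lam n / ((n - n / K : ℕ) : ℝ) / 2 := by
      have h1 := le_penalty_div (q := p n) hcard' (Nat.sub_le n (n / K)) hc.le hσn hC0.le
      have h2 : T * ((2 + 2 * B) * (3 * B ^ 2)) * (1 + M) * 2 ≤ C * c := (div_le_iff₀ hc).1 hC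
      have h3 := mul_le_mul_of_nonneg_right h2
        (Real.sqrt_nonneg (Real.log (p n) / ((n - n / K : ℕ) : ℝ)))
      rw [le_div_iff₀ two_pos]
      refine le_trans ?_ h1
      rw [hτ₁]
      linarith
    have hgood := measure_not_forall_momentsClose_le (hindep n) (hident n) hB hbn hK hn
      (by omega) hdvd' (hfold n hdvd')
    -- Covering the whole space and using subadditivity avoids any measurability question for the
    -- failure event.
    have hsub : (Set.univ : Set Ω) ⊆ {ω | that n ω = tstar} ∪ {ω | ¬ ∀ κ,
        MomentsClose (uniformOn (foldSet (fold n) κ : Set (Fin n))) P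
          (fun i => Wobs n i ω) (W n) (τ₂ n) ∧
        MomentsClose (uniformOn (((foldSet (fold n) κ)ᶜ : Finset (Fin n)) : Set (Fin n))) P
          (fun i => Wobs n i ω) (W n) (τ₁ n)} := by
      intro ω _
      by_contra hω
      simp only [Set.mem_union, Set.mem_ofPred_eq, not_or, not_not] at hω
      obtain ⟨hne, hclose⟩ := hω
      have hcv : ∀ t ∈ Finset.Icc 1 T,
          |cvRisk (fun i => Wobs n i ω) (fold n) (est n ω t) t - risk P (W n) t (Lstar n t)| ≤
            2 * rowDev T B M (r n) (τ₁ n) (τ₂ n) := fun t ht =>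
        abs_cvRisk_sub_risk_le (hW2 n) hB hbn (Finset.mem_Icc.1 ht).2 (hLstar n t ht)
          (hsn t ht) hγ (hREn t ht) hK hn (by omega) hdvd' (hfold n hdvd')
          (hest n hn hdvd' ω t ht) hM hclose (by positivity) hτ₁n (by positivity) hτ₂n hlam
          hτlam hτγn rfl
      obtain ⟨hmem, hmin⟩ := hthat n hn hdvd' ω
      have htstar' : tstar ∈ Finset.Icc 1 T := by
        rw [Finset.mem_Icc] at htstar ⊢
        omega
      have h1 := hcv _ hmem
      have h2 := hcv _ htstar'
      have h3 := hmin _ htstar'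
      have h4 := hgapn _ hmem hne
      rw [abs_le] at h1 h2
      linarith [h1.1, h2.2]
    rw [tsub_le_iff_right]
    calc (1 : ENNReal) = P Set.univ := measure_univ.symm
      _ ≤ _ := (measure_mono hsub).trans ((measure_union_le _ _).trans
          (add_le_add le_rfl hgood))
  have hlim : Tendsto (fun n => 1 - K * (2 * ENNReal.ofReal (4 * (T + 1) ^ 2 / p n))) l
      (𝓝 (1 : ENNReal)) := by
    have h1 : Tendsto (fun n => (4 * ((T : ℝ) + 1) ^ 2 / p n)) atTop (𝓝 0) :=
      (tendsto_natCast_atTop_atTop.comp hp).const_div_atTop _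
    have h2 := (ENNReal.tendsto_ofReal h1).mono_left hle
    rw [ENNReal.ofReal_zero] at h2
    have h3 := ENNReal.Tendsto.const_mul (a := (K : ENNReal))
      (ENNReal.Tendsto.const_mul (a := 2) h2 (Or.inr ENNReal.ofNat_ne_top))
      (Or.inr (ENNReal.natCast_ne_top K))
    rw [mul_zero, mul_zero] at h3
    have h4 := ENNReal.Tendsto.sub (tendsto_const_nhds (x := (1 : ENNReal)) (f := l)) h3
      (Or.inl ENNReal.one_ne_top)
    rwa [tsub_zero] at h4
  exact tendsto_of_tendsto_of_tendsto_of_le_of_le' hlim tendsto_const_nhds hbad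
    (Eventually.of_forall fun n => prob_le_one)
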